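/- **Setting.** Let $k$ be a field, let $I$ be a finite set, and let $\mathbb A=(a_{ij})_{i,j\in I}$ be a Cartan matrix of finite type, i.e. each irreducible component of $\mathbb A$ (connected component of its Dynkin diagram) is, up to relabelling, the Cartan matrix of one of the types $A_n$ $(n\ge1)$, $B_n$ $(n\ge 2)$, $C_n$ $(n\ge 3)$, $D_n$ $(n\ge 4)$, $E_6,E_7,E_8,F_4,G_2$. Let $\mathrm{diag}(d_i)_{i\in I}$ be its standard symmetrization: $d_i\in\{1,2,3\}$, $d_ia_{ij}=d_ja_{ji}$ for all $i,j$, and every irreducible component contains an $i$ with $d_i=1$. Let $l>1$ be an odd integer, not a multiple of $3$ if $\mathbb A$ has an irreducible component of type $G_2$, and suppose that $k$ contains a primitive $l$-th root of unity $q$. Let $G$ be the abelian group generated by $K_i$ $(i\in I)$ with defining relations $K_i^l=1$, and let $\tau_0:G\times G\to k^\times$ be the bimultiplicative map with $\tau_0(K_i,K_j)=q^{-d_ia_{ij}}$. Let $V=\bigoplus_i kv_i$ and $W=\bigoplus_i kw_i$ be the Yetter–Drinfeld modules over $G$ with $$g\rightharpoonup v_i=\tau_0(g,K_i)\,v_i,\quad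 v_i\mapsto K_i\otimes v_i,\qquad g\rightharpoonup w_i=\tau_0(K_i,g)^{-1}w_i,\quad w_i\mapsto K_i\otimes w_i .$$ Let $R=T(V)/\mathfrak a$ and $S=T(W)/\mathfrak b$ be pre-Nichols algebras of $V$ and $W$, i.e. $\mathfrak a\subset T(V)$ and $\mathfrak b\subset T(W)$ are homogeneous braided Hopf ideals with $\mathfrak a\cap V=0$, $\mathfrak b\cap W=0$. Let $\mathcal D$ be the associated generalized quantum double of the bosonizations of $R$ and $S$ by $G$: the Hopf algebra generated by the group $G\times G$ and by $v_i,w_i$ $(i\in I)$, where the $v_i$ satisfy the relations $\mathfrak a$, the $w_i$ satisfy the relations $\mathfrak b$, and, for $(a,b)\in G\times G$ and $i,j\in I$, $$(a,b)\,v_i=\tau_0(a,K_i)\tau_0(K_i,b)\,v_i\,(a,b),\qquad w_i\,(a,b)=\tau_0(a,K_i)\tau_0(K_i,b)\,(a,b)\,w_i,$$ $$w_jv_i=\tau_0(K_i,K_j)\,v_iw_j+\delta_{ij}\big((K_i,K_i)-1\big),$$ with all elements of $G\times G$ grouplike, $\Delta(v_i)=v_i\otimes1+(K_i,1)\otimes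 v_i$ and $\Delta(w_i)=w_i\otimes 1+(1,K_i)\otimes w_i$. Put $$T=\{(g,g^{-1})\mid g\in G\},\qquad C=\{(a,b)\in G\times G\mid \tau_0(a,K_i)\tau_0(K_i,b)=1\ \ \forall i\in I\},\qquad P=\langle (K_i,K_i)\mid i\in I\rangle ,$$ so that $C$ consists of grouplikes that are central in $\mathcal D$, and define the quotient Hopf algebras $$\mathcal D_t=\mathcal D/\big((K_i,1)-(1,K_i)\mid i\in I\big),\qquad \mathcal D_c=\mathcal D/(c-1\mid c\in C).$$ **Claim (Krop).** The following are equivalent: 1. $T=C$; 2. $C\cap P=\{1\}$; 3. $\tau_0$ is non-degenerate; 4. $l$ is prime to $\det\mathbb A$; 5. $\mathbb A$ has no irreducible component of type $A_n$ with $n+1$ not prime to $l$, and, if $3\mid l$, no irreducible component of type $E_6$. If these conditions hold, then $\mathcal D_t=\mathcal D_c$ (the two defining ideals of $\mathcal D$ coincide), and moreover: - the Hopf algebra map $kC\hookrightarrow\mathcal D$ splits, i.e. there is a Hopf algebra map $\pi:\mathcal D\to kC$ that is the identity on $kC$; - there is an algebra isomorphism $\mathcal D\cong kC\otimes\mathcal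 D_c$ that is an isomorphism of right $\mathcal D_c$-comodules, and also one that is an isomorphism of left $\mathcal D_c$-comodules; here $\mathcal D$ is a $\mathcal D_c$-comodule through its coproduct and the projection $\mathcal D\to\mathcal D_c$, and $kC\otimes\mathcal D_c$ is one through the coproduct of $\mathcal D_c$. -/

import Mathlib

open scoped TensorProduct

noncomputable section

namespace GQD

universe u v w x

/-! ### The braided tensor algebra of a diagonal Yetter-Drinfeld module, pre-Nichols algebras

`Γ` is an abelian group and `V = ⨁ k v_i` is the Yetter-Drinfeld module over `Γ` in which
`x ∈ Γ` acts on `v_i` by the scalar `χ_i(x)` and the coaction is `v_i ↦ d_i ⊗ v_i`.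
Its tensor algebra `T(V)` is the free algebra on the `v_i`. -/

section Braided

variable {k : Type u} [Field k] {I : Type v} {Γ : Type w} [CommGroup Γ]

/-- The subspace `V ⊆ T(V)`. -/
def genSpace (k : Type u) [Field k] (I : Type v) : Submodule k (FreeAlgebra k I) :=
  Submodule.span k (Set.range (FreeAlgebra.ι k))

/-- The action of `x ∈ Γ` on `T(V)`. -/
def act (χ : I → Γ →* kˣ) (x : Γ) : FreeAlgebra k I →ₐ[k] FreeAlgebra k I :=
  FreeAlgebra.lift k fun i => (χ i x : k) • FreeAlgebra.ι k i

/-- The coaction `T(V) → kΓ ⊗ T(V)`. -/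
def coact (k : Type u) [Field k] {I : Type v} {Γ : Type w} [CommGroup Γ] (d : I → Γ) : FreeAlgebra k I →ₐ[k] MonoidAlgebra k Γ ⊗[k] FreeAlgebra k I :=
  FreeAlgebra.lift k fun i => MonoidAlgebra.of k Γ (d i) ⊗ₜ[k] FreeAlgebra.ι k i

/-- Left multiplication by `Δ(v_i) = v_i ⊗ 1 + 1 ⊗ v_i` in the braided tensor product algebra of
`T(V)` with itself, whose product is `(a ⊗ b)(a' ⊗ b') = a (b₋₁ ⇀ a') ⊗ b₀ b'`; explicitly
`a ⊗ b ↦ v_i a ⊗ b + (d_i ⇀ a) ⊗ v_i b`. -/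
def brComulMul (χ : I → Γ →* kˣ) (d : I → Γ) (i : I) :
    Module.End k (FreeAlgebra k I ⊗[k] FreeAlgebra k I) :=
  TensorProduct.map (LinearMap.mulLeft k (FreeAlgebra.ι k i)) LinearMap.id +
    TensorProduct.map (act χ (d i)).toLinearMap (LinearMap.mulLeft k (FreeAlgebra.ι k i))

/-- The braided coproduct of `T(V)`: the algebra map from `T(V)` to the braided tensor product of
`T(V)` with itself for which all elements of `V` are primitive; that is,
`Δ(v_{i₁} ⋯ v_{iₙ}) = Δ(v_{i₁}) ⋯ Δ(v_{iₙ}) (1 ⊗ 1)`. -/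
def brComul (χ : I → Γ →* kˣ) (d : I → Γ) :
    FreeAlgebra k I →ₗ[k] FreeAlgebra k I ⊗[k] FreeAlgebra k I :=
  LinearMap.applyₗ (1 ⊗ₜ[k] 1) ∘ₗ (FreeAlgebra.lift k (brComulMul χ d)).toLinearMap

/-- The counit of `T(V)`. -/
def brCounit (k : Type u) [Field k] (I : Type v) : FreeAlgebra k I →ₐ[k] k :=
  FreeAlgebra.lift k fun _ => 0

/-- The braided antipode of `T(V)`: the linear map with `S(1) = 1` and
`S(v_i a) = (d_i ⇀ S(a)) S(v_i) = - (d_i ⇀ S(a)) v_i`. -/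
def brAntipode (χ : I → Γ →* kˣ) (d : I → Γ) : FreeAlgebra k I →ₗ[k] FreeAlgebra k I :=
  LinearMap.applyₗ 1 ∘ₗ (FreeAlgebra.lift k fun i =>
    (-(LinearMap.mulRight k (FreeAlgebra.ι k i) ∘ₗ (act χ (d i)).toLinearMap) :
      Module.End k (FreeAlgebra k I))).toLinearMap

/-- A pre-Nichols algebra `T(V) / 𝔞` of `V`, given by its ideal `𝔞` of relations: a homogeneous
braided Hopf ideal of `T(V)` (in the category of Yetter-Drinfeld modules) with `𝔞 ∩ V = 0`. -/
structure PreNichols (χ : I → Γ →* kˣ) (d : I → Γ) where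
  /-- the underlying subspace of `T(V)` -/
  rel : Submodule k (FreeAlgebra k I)
  mul_mem_left : ∀ a b, b ∈ rel → a * b ∈ rel
  mul_mem_right : ∀ a b, a ∈ rel → a * b ∈ rel
  act_mem : ∀ x, ∀ a ∈ rel, act χ x a ∈ rel
  coact_mem : ∀ a ∈ rel, coact k d a ∈
    LinearMap.range (TensorProduct.map (LinearMap.id : MonoidAlgebra k Γ →ₗ[k] _) rel.subtype)
  homogeneous : rel ≤ ⨆ n : ℕ, rel ⊓ genSpace k I ^ n
  comul_mem : ∀ a ∈ rel, brComul χ d a ∈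
    LinearMap.range (TensorProduct.map rel.subtype (LinearMap.id : FreeAlgebra k I →ₗ[k] _)) ⊔
    LinearMap.range (TensorProduct.map (LinearMap.id : FreeAlgebra k I →ₗ[k] _) rel.subtype)
  counit_eq_zero : ∀ a ∈ rel, brCounit k I a = 0
  antipode_mem : ∀ a ∈ rel, brAntipode χ d a ∈ rel
  disjoint : Disjoint rel (genSpace k I)

/-! Transfer of the braided structure maps to an algebra containing the bosonization. -/

variable {A : Type x} [Ring A] [Algebra k A] {χ : I → Γ →* kˣ} {d : I → Γ}
  {φ : FreeAlgebra k I →ₐ[k] A} {γ : Γ →* A}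

theorem act_comm (h : ∀ i y, γ y * φ (FreeAlgebra.ι k i) =
      (χ i y : k) • (φ (FreeAlgebra.ι k i) * γ y)) (y : Γ) (a : FreeAlgebra k I) :
    γ y * φ a = φ (act χ y a) * γ y := by
  induction a using FreeAlgebra.induction with
  | grade0 r => simp [Algebra.commutes]
  | grade1 i => simp [act, h]
  | mul a b ha hb => simp only [map_mul]; rw [← mul_assoc, ha, mul_assoc, hb, mul_assoc]
  | add a b ha hb => simp only [map_add, mul_add, add_mul, ha, hb]

theorem comul_rel (R : PreNichols χ d)
    (h : ∀ i y, γ y * φ (FreeAlgebra.ι k i) = (χ i y : k) • (φ (FreeAlgebra.ι k i) * γ y))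
    (E : FreeAlgebra k I →ₐ[k] A ⊗[k] A)
    (hE : ∀ i, E (FreeAlgebra.ι k i) =
      φ (FreeAlgebra.ι k i) ⊗ₜ 1 + γ (d i) ⊗ₜ φ (FreeAlgebra.ι k i))
    (hφ : ∀ a ∈ R.rel, φ a = 0) : ∀ a ∈ R.rel, E a = 0 := by
  -- `Φ (y ⊗ b) = γ y ⊗ φ b`, `Θ (a ⊗ b) = φ a • Φ (coact b)`
  let Φ : MonoidAlgebra k Γ ⊗[k] FreeAlgebra k I →ₗ[k] A ⊗[k] A :=
    TensorProduct.map (MonoidAlgebra.lift k A Γ γ).toLinearMap φ.toLinearMap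
  let Θ : FreeAlgebra k I ⊗[k] FreeAlgebra k I →ₗ[k] A ⊗[k] A :=
    TensorProduct.lift (((LinearMap.mul k (A ⊗[k] A)).compl₂ (Φ ∘ₗ (coact k d).toLinearMap)) ∘ₗ
      (Algebra.TensorProduct.includeLeft : A →ₐ[k] A ⊗[k] A).toLinearMap ∘ₗ φ.toLinearMap)
  have hΘ : ∀ a b, Θ (a ⊗ₜ b) = (φ a ⊗ₜ 1) * Φ (coact k d b) := fun a b => rfl
  have hΦmul : ∀ s t, Φ (s * t) = Φ s * Φ t := by
    intro s t
    exact map_mul (Algebra.TensorProduct.map (MonoidAlgebra.lift k A Γ γ) φ) s t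
  have key : ∀ (a : FreeAlgebra k I) (t : FreeAlgebra k I ⊗[k] FreeAlgebra k I),
      Θ (FreeAlgebra.lift k (brComulMul χ d) a t) = E a * Θ t := by
    intro a
    induction a using FreeAlgebra.induction with
    | grade0 r => intro t; simp [Algebra.smul_def]
    | grade1 i =>
      intro t
      induction t with
      | zero => simp
      | add s t hs ht => simp only [map_add, mul_add, hs, ht]
      | tmul a b =>
        rw [FreeAlgebra.lift_ι_apply, hE]
        simp only [brComulMul, LinearMap.add_apply, TensorProduct.map_tmul,
          LinearMap.mulLeft_apply, LinearMap.id_apply, map_add, hΘ, map_mul, hΦmul, add_mul]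
        congr 1
        · rw [← mul_assoc]; simp
        · have : Φ (coact k d (FreeAlgebra.ι k i)) = γ (d i) ⊗ₜ φ (FreeAlgebra.ι k i) := by
            simp [Φ, coact]
          rw [this, ← mul_assoc, ← mul_assoc]
          congr 1
          simp only [Algebra.TensorProduct.tmul_mul_tmul, one_mul, mul_one, AlgHom.coe_toLinearMap]
          rw [act_comm h]
    | mul a b ha hb => intro t; rw [map_mul, Module.End.mul_apply, ha, hb, map_mul, mul_assoc]
    | add a b ha hb => intro t; simp only [map_add, LinearMap.add_apply, add_mul, ha, hb]
  have hE' : ∀ a, E a = Θ (brComul χ d a) := by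
    intro a
    have := key a (1 ⊗ₜ 1)
    have h1 : Θ (1 ⊗ₜ 1) = 1 := by
      rw [hΘ]; simp [Φ, Algebra.TensorProduct.one_def]
    rw [h1, mul_one] at this
    rw [← this]; rfl
  intro a ha
  rw [hE']
  have hle : LinearMap.range (TensorProduct.map R.rel.subtype
      (LinearMap.id : FreeAlgebra k I →ₗ[k] _)) ⊔
      LinearMap.range (TensorProduct.map (LinearMap.id : FreeAlgebra k I →ₗ[k] _)
        R.rel.subtype) ≤ LinearMap.ker Θ := by
    rw [sup_le_iff, LinearMap.range_le_ker_iff, LinearMap.range_le_ker_iff]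
    constructor
    · ext a b
      simp [hΘ, hφ a.1 a.2]
    · have hΦ0 : LinearMap.range (TensorProduct.map (LinearMap.id : MonoidAlgebra k Γ →ₗ[k] _)
          R.rel.subtype) ≤ LinearMap.ker Φ := by
        rw [LinearMap.range_le_ker_iff]
        apply TensorProduct.ext'
        intro y b
        simp [Φ, hφ b.1 b.2]
      apply TensorProduct.ext'
      intro a b
      have := LinearMap.mem_ker.1 (hΦ0 (R.coact_mem b.1 b.2))
      simp [hΘ, this]
  exact hle (R.comul_mem a ha)

theorem antipode_rel (R : PreNichols χ d)
    (h : ∀ i y, γ y * φ (FreeAlgebra.ι k i) = (χ i y : k) • (φ (FreeAlgebra.ι k i) * γ y))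
    (S : FreeAlgebra k I →ₐ[k] Aᵐᵒᵖ)
    (hS : ∀ i, S (FreeAlgebra.ι k i) = MulOpposite.op (-(γ (d i)⁻¹ * φ (FreeAlgebra.ι k i))))
    (hφ : ∀ a ∈ R.rel, φ a = 0) : ∀ a ∈ R.rel, S a = 0 := by
  let γ' : MonoidAlgebra k Γ →ₗ[k] A :=
    (MonoidAlgebra.lift k A Γ (γ.comp (invMonoidHom : Γ →* Γ))).toLinearMap
  let Ψ : MonoidAlgebra k Γ ⊗[k] FreeAlgebra k I →ₗ[k] A :=
    LinearMap.mul' k A ∘ₗ TensorProduct.map γ' (φ.toLinearMap ∘ₗ brAntipode χ d)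
  have hΨ : ∀ y b, Ψ (MonoidAlgebra.of k Γ y ⊗ₜ b) = γ y⁻¹ * φ (brAntipode χ d b) := by
    intro y b; simp [Ψ, γ']
  have hbr : ∀ i b, brAntipode χ d (FreeAlgebra.ι k i * b) =
      -(act χ (d i) (brAntipode χ d b) * FreeAlgebra.ι k i) := by
    intro i b
    simp [brAntipode, map_mul, FreeAlgebra.lift_ι_apply]
  have step : ∀ i t, Ψ ((MonoidAlgebra.of k Γ (d i) ⊗ₜ FreeAlgebra.ι k i) * t) =
      Ψ t * (S (FreeAlgebra.ι k i)).unop := by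
    intro i t
    induction t with
    | zero => simp
    | add s t hs ht => simp only [mul_add, map_add, add_mul, hs, ht]
    | tmul m b =>
      induction m using MonoidAlgebra.induction_linear with
      | zero => simp
      | add s t hs ht =>
        simp only [TensorProduct.add_tmul, mul_add, map_add, add_mul, hs, ht]
      | single y r =>
        have : MonoidAlgebra.single y r = r • MonoidAlgebra.of k Γ y := by simp
        rw [this, ← TensorProduct.smul_tmul', mul_smul_comm, map_smul, map_smul, smul_mul_assoc]
        congr 1
        rw [Algebra.TensorProduct.tmul_mul_tmul, ← map_mul, hΨ, hΨ, hbr, hS]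
        have e := act_comm h (d i)⁻¹ (act χ (d i) (brAntipode χ d b))
        have e2 : act χ (d i)⁻¹ (act χ (d i) (brAntipode χ d b)) = brAntipode χ d b := by
          have : (act χ (d i)⁻¹).comp (act χ (d i)) = AlgHom.id k (FreeAlgebra k I) := by
            ext j
            simp [act, smul_smul]
          exact DFunLike.congr_fun this _
        rw [e2] at e
        rw [mul_inv_rev, map_mul, map_neg, map_mul, MulOpposite.unop_op, mul_neg, mul_neg]
        congr 1
        rw [mul_assoc, ← mul_assoc (γ (d i)⁻¹), e]
        simp only [mul_assoc]
  have key : ∀ a b, Ψ (coact k d (a * b)) = Ψ (coact k d b) * (S a).unop := by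
    intro a
    induction a using FreeAlgebra.induction with
    | grade0 r =>
      intro b
      simp [← Algebra.smul_def]
      rw [Algebra.smul_def, Algebra.commutes]
    | grade1 i =>
      intro b
      rw [map_mul, ← step]
      simp [coact]
    | mul a b ha hb => intro t; rw [mul_assoc, ha, hb, map_mul, MulOpposite.unop_mul, mul_assoc]
    | add a b ha hb => intro t; simp only [add_mul, map_add, MulOpposite.unop_add, mul_add, ha, hb]
  intro a ha
  apply MulOpposite.unop_injective
  have h1 : Ψ (coact k d 1) = 1 := by
    have := hΨ 1 1
    simpa [brAntipode, Algebra.TensorProduct.one_def, MonoidAlgebra.one_def] using this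
  have := key a 1
  rw [h1, one_mul, mul_one] at this
  rw [← this, MulOpposite.unop_zero]
  have hle : LinearMap.range (TensorProduct.map (LinearMap.id : MonoidAlgebra k Γ →ₗ[k] _)
      R.rel.subtype) ≤ LinearMap.ker Ψ := by
    rw [LinearMap.range_le_ker_iff]
    apply TensorProduct.ext'
    intro y b
    simp [Ψ, hφ _ (R.antipode_mem b.1 b.2)]
  exact hle (R.coact_mem a ha)

end Braided

/-! ### The generalized quantum double -/

section Double

variable {k : Type u} [Field k] {I : Type v} {F G : Type w} [CommGroup F] [CommGroup G]

/-- The characters `ĝ_i = τ₀(-, g_i)` of `F`, by which `F` acts on `V = ⨁ (k v_i; ĝ_i, f_i)`. -/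
def leftChar (τ₀ : F →* G →* kˣ) (g : I → G) (i : I) : F →* kˣ := τ₀.flip (g i)

/-- The characters `f̂_i⁻¹ = τ₀(f_i, -)⁻¹` of `G`, by which `G` acts on
`W = ⨁ (k w_i; f̂_i⁻¹, g_i)`. -/
def rightChar (τ₀ : F →* G →* kˣ) (f : I → F) (i : I) : G →* kˣ := (τ₀ (f i))⁻¹

/-- The generators `v_i`, `w_i` and `x ∈ F × G` of the generalized quantum double. -/
inductive Gen (I : Type v) (F G : Type w) : Type (max v w)
  | v (i : I) : Gen I F G
  | w (i : I) : Gen I F G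
  | grp (x : F × G) : Gen I F G

variable {τ₀ : F →* G →* kˣ} {f : I → F} {g : I → G}

local notation "gV" i => FreeAlgebra.ι k (Gen.v (F := F) (G := G) i)
local notation "gW" i => FreeAlgebra.ι k (Gen.w (F := F) (G := G) i)
local notation "gX" x => FreeAlgebra.ι k (Gen.grp (I := I) x)

/-- The defining relations of the generalized quantum double of the bosonizations
`B = R ⋊ F`, `H = S ⋊ G` of pre-Nichols algebras `R` of `V` and `S` of `W`. For
`x = (a, b) ∈ F × G` the scalar in `conj_v`, `conj_w` is `τ₀(a, g_i) τ₀(f_i, b)`; so these two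
relations are, together, the commutation rules `a v_i = ĝ_i(a) v_i a` of `B`, `b w_i = f̂_i⁻¹(b) w_i b` of `H`, and
`b v_i = τ₀(f_i, b) v_i b`, `w_i a = τ₀(a, g_i) a w_i` (`a ∈ F`, `b ∈ G`). -/
inductive DoubleRel (R : PreNichols (leftChar τ₀ g) f) (S : PreNichols (rightChar τ₀ f) g) :
    FreeAlgebra k (Gen I F G) → FreeAlgebra k (Gen I F G) → Prop
  | grp_one : DoubleRel R S (gX (1 : F × G)) 1
  | grp_mul (x y : F × G) : DoubleRel R S (gX (x * y)) ((gX x) * (gX y))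
  | conj_v (x : F × G) (i : I) : DoubleRel R S ((gX x) * (gV i))
      (((τ₀ x.1 (g i) * τ₀ (f i) x.2 : kˣ) : k) • ((gV i) * (gX x)))
  | conj_w (x : F × G) (i : I) : DoubleRel R S ((gW i) * (gX x))
      (((τ₀ x.1 (g i) * τ₀ (f i) x.2 : kˣ) : k) • ((gX x) * (gW i)))
  | cross_same (i : I) : DoubleRel R S ((gW i) * (gV i))
      ((τ₀ (f i) (g i) : k) • ((gV i) * (gW i)) + ((gX (f i, g i)) - 1))
  | cross_ne (i j : I) (h : i ≠ j) : DoubleRel R S ((gW j) * (gV i))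
      ((τ₀ (f i) (g j) : k) • ((gV i) * (gW j)))
  | rel_v (a : FreeAlgebra k I) (ha : a ∈ R.rel) :
      DoubleRel R S (FreeAlgebra.lift k (fun i => gV i) a) 0
  | rel_w (a : FreeAlgebra k I) (ha : a ∈ S.rel) :
      DoubleRel R S (FreeAlgebra.lift k (fun i => gW i) a) 0

/-- The generalized quantum double `𝒟 = (R ⋊ F) ⋈ (S ⋊ G)` associated to `τ₀`, as an algebra. -/
def Double (R : PreNichols (leftChar τ₀ g) f) (S : PreNichols (rightChar τ₀ f) g) :
    Type (max u v w) :=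
  RingQuot (DoubleRel R S)

namespace Double

variable (R : PreNichols (leftChar τ₀ g) f) (S : PreNichols (rightChar τ₀ f) g)

instance : Ring (Double R S) := inferInstanceAs (Ring (RingQuot (DoubleRel R S)))
instance : Algebra k (Double R S) := inferInstanceAs (Algebra k (RingQuot (DoubleRel R S)))

/-- The projection from the free algebra. -/
def mk : FreeAlgebra k (Gen I F G) →ₐ[k] Double R S := RingQuot.mkAlgHom k (DoubleRel R S)

/-- The generator `v_i` of `𝒟`. -/
def v (i : I) : Double R S := mk R S (gV i)

/-- The generator `w_i` of `𝒟`. -/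
def w (i : I) : Double R S := mk R S (gW i)

theorem mk_rel {a b : FreeAlgebra k (Gen I F G)} (h : DoubleRel R S a b) :
    mk R S a = mk R S b := RingQuot.mkAlgHom_rel k h

/-- The group map from `F × G` to `𝒟`. -/
def grp : F × G →* Double R S where
  toFun x := mk R S (gX x)
  map_one' := by rw [mk_rel R S .grp_one, map_one]
  map_mul' x y := by rw [mk_rel R S (.grp_mul x y), map_mul]

theorem grp_v (x : F × G) (i : I) : grp R S x * v R S i =
    ((τ₀ x.1 (g i) * τ₀ (f i) x.2 : kˣ) : k) • (v R S i * grp R S x) := by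
  have := mk_rel R S (.conj_v x i)
  rwa [map_mul, map_smul, map_mul] at this

theorem w_grp (x : F × G) (i : I) : w R S i * grp R S x =
    ((τ₀ x.1 (g i) * τ₀ (f i) x.2 : kˣ) : k) • (grp R S x * w R S i) := by
  have := mk_rel R S (.conj_w x i)
  rwa [map_mul, map_smul, map_mul] at this

theorem w_v_same (i : I) : w R S i * v R S i =
    (τ₀ (f i) (g i) : k) • (v R S i * w R S i) + (grp R S (f i, g i) - 1) := by
  have := mk_rel R S (.cross_same i)
  rwa [map_mul, map_add, map_smul, map_mul, map_sub, map_one] at this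

theorem w_v_ne (i j : I) (h : i ≠ j) : w R S j * v R S i =
    (τ₀ (f i) (g j) : k) • (v R S i * w R S j) := by
  have := mk_rel R S (.cross_ne i j h)
  rwa [map_mul, map_smul, map_mul] at this

theorem lift_v (a : FreeAlgebra k I) (ha : a ∈ R.rel) : FreeAlgebra.lift k (v R S) a = 0 := by
  have := mk_rel R S (.rel_v a ha)
  rw [map_zero, ← AlgHom.comp_apply] at this
  rw [← this]
  congr 1
  ext i
  simp [v]

theorem lift_w (a : FreeAlgebra k I) (ha : a ∈ S.rel) : FreeAlgebra.lift k (w R S) a = 0 := by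
  have := mk_rel R S (.rel_w a ha)
  rw [map_zero, ← AlgHom.comp_apply] at this
  rw [← this]
  congr 1
  ext i
  simp [w]

variable {R S} in
/-- The universal property of `𝒟`. -/
def lift {A : Type x} [Ring A] [Algebra k A] (a b : I → A) (γ : F × G →* A)
    (h1 : ∀ x i, γ x * a i = ((τ₀ x.1 (g i) * τ₀ (f i) x.2 : kˣ) : k) • (a i * γ x))
    (h2 : ∀ x i, b i * γ x = ((τ₀ x.1 (g i) * τ₀ (f i) x.2 : kˣ) : k) • (γ x * b i))
    (h3 : ∀ i, b i * a i = (τ₀ (f i) (g i) : k) • (a i * b i) + (γ (f i, g i) - 1))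
    (h4 : ∀ i j, i ≠ j → b j * a i = (τ₀ (f i) (g j) : k) • (a i * b j))
    (h5 : ∀ r ∈ R.rel, FreeAlgebra.lift k a r = 0)
    (h6 : ∀ r ∈ S.rel, FreeAlgebra.lift k b r = 0) : Double R S →ₐ[k] A :=
  RingQuot.liftAlgHom k ⟨FreeAlgebra.lift k fun
    | .v i => a i
    | .w i => b i
    | .grp x => γ x, by
    intro s t hst
    induction hst with
    | grp_one => simp
    | grp_mul x y => simp
    | conj_v x i => simpa using h1 x i
    | conj_w x i => simpa using h2 x i
    | cross_same i => simpa using h3 i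
    | cross_ne i j h => simpa using h4 i j h
    | rel_v r hr =>
      rw [map_zero, ← h5 r hr, ← AlgHom.comp_apply]
      congr 1
      ext i
      simp
    | rel_w r hr =>
      rw [map_zero, ← h6 r hr, ← AlgHom.comp_apply]
      congr 1
      ext i
      simp⟩

section lift

variable {R S} {A : Type x} [Ring A] [Algebra k A] {a b : I → A} {γ : F × G →* A}
    {h1 : ∀ x i, γ x * a i = ((τ₀ x.1 (g i) * τ₀ (f i) x.2 : kˣ) : k) • (a i * γ x)}
    {h2 : ∀ x i, b i * γ x = ((τ₀ x.1 (g i) * τ₀ (f i) x.2 : kˣ) : k) • (γ x * b i)}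
    {h3 : ∀ i, b i * a i = (τ₀ (f i) (g i) : k) • (a i * b i) + (γ (f i, g i) - 1)}
    {h4 : ∀ i j, i ≠ j → b j * a i = (τ₀ (f i) (g j) : k) • (a i * b j)}
    {h5 : ∀ r ∈ R.rel, FreeAlgebra.lift k a r = 0}
    {h6 : ∀ r ∈ S.rel, FreeAlgebra.lift k b r = 0}

@[simp] theorem lift_apply_v (i : I) : lift a b γ h1 h2 h3 h4 h5 h6 (v R S i) = a i := by
  unfold lift v mk
  exact (RingQuot.liftAlgHom_mkAlgHom_apply _ _ _ _).trans (by simp)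

@[simp] theorem lift_apply_w (i : I) : lift a b γ h1 h2 h3 h4 h5 h6 (w R S i) = b i := by
  unfold lift w mk
  exact (RingQuot.liftAlgHom_mkAlgHom_apply _ _ _ _).trans (by simp)

@[simp] theorem lift_apply_grp (x : F × G) :
    lift a b γ h1 h2 h3 h4 h5 h6 (grp R S x) = γ x := by
  unfold lift grp mk
  exact (RingQuot.liftAlgHom_mkAlgHom_apply _ _ _ _).trans (by simp)

end lift

variable {R S} in
theorem algHom_ext {A : Type x} [Ring A] [Algebra k A] {α β : Double R S →ₐ[k] A}
    (h1 : ∀ i, α (v R S i) = β (v R S i)) (h2 : ∀ i, α (w R S i) = β (w R S i))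
    (h3 : ∀ x, α (grp R S x) = β (grp R S x)) : α = β := by
  refine RingQuot.ringQuot_ext' k _ _ ?_
  ext y
  cases y with
  | v i => exact h1 i
  | w i => exact h2 i
  | grp x => exact h3 x

/-! The Hopf algebra structure: `x ∈ F × G` is grouplike,
`Δ(v_i) = v_i ⊗ 1 + f_i ⊗ v_i` and `Δ(w_i) = w_i ⊗ 1 + g_i ⊗ w_i`. -/

/-- The coproduct on grouplikes. -/
def grpComul : F × G →* Double R S ⊗[k] Double R S where
  toFun x := grp R S x ⊗ₜ grp R S x
  map_one' := by simp [Algebra.TensorProduct.one_def]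
  map_mul' := by simp

/-- The antipode on grouplikes. -/
def grpAntipode : F × G →* (Double R S)ᵐᵒᵖ where
  toFun x := MulOpposite.op (grp R S x⁻¹)
  map_one' := by simp
  map_mul' x y := by rw [← MulOpposite.op_mul, ← map_mul, mul_inv_rev]

theorem grpComul_apply (x : F × G) : grpComul R S x = grp R S x ⊗ₜ grp R S x := rfl

theorem grpAntipode_apply (x : F × G) :
    grpAntipode R S x = MulOpposite.op (grp R S x⁻¹) := rfl

/-- The coproduct of `𝒟`. -/
def comulHom : Double R S →ₐ[k] Double R S ⊗[k] Double R S :=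
  lift (fun i => v R S i ⊗ₜ 1 + grp R S (f i, 1) ⊗ₜ v R S i)
    (fun i => w R S i ⊗ₜ 1 + grp R S (1, g i) ⊗ₜ w R S i)
    (grpComul R S)
    (by
      intro x i
      simp only [grpComul_apply, mul_add, add_mul,
        Algebra.TensorProduct.tmul_mul_tmul, grp_v, mul_one, one_mul, smul_add,
        TensorProduct.smul_tmul', TensorProduct.tmul_smul, ← map_mul, mul_comm x])
    (by
      intro x i
      simp only [grpComul_apply, mul_add, add_mul,
        Algebra.TensorProduct.tmul_mul_tmul, w_grp, mul_one, one_mul, smul_add,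
        TensorProduct.smul_tmul', TensorProduct.tmul_smul, ← map_mul, mul_comm x])
    (by
      intro i
      have e1 := w_grp R S (f i, 1) i
      have e2 := grp_v R S (1, g i) i
      simp only [map_one, mul_one, one_mul, MonoidHom.one_apply] at e1 e2
      simp only [grpComul_apply, mul_add, add_mul,
        Algebra.TensorProduct.tmul_mul_tmul, mul_one, one_mul, smul_add, e1, e2, w_v_same,
        TensorProduct.smul_tmul', TensorProduct.tmul_smul, ← map_mul, Prod.mk_mul_mk,
        TensorProduct.tmul_add, TensorProduct.add_tmul, TensorProduct.tmul_sub,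
        TensorProduct.sub_tmul, Algebra.TensorProduct.one_def]
      abel)
    (by
      intro i j h
      have e1 := w_grp R S (f i, 1) j
      have e2 := grp_v R S (1, g j) i
      simp only [map_one, mul_one, one_mul, MonoidHom.one_apply] at e1 e2
      simp only [mul_add, add_mul,
        Algebra.TensorProduct.tmul_mul_tmul, mul_one, one_mul, smul_add, e1, e2, w_v_ne R S i j h,
        TensorProduct.smul_tmul', TensorProduct.tmul_smul, ← map_mul, Prod.mk_mul_mk]
      abel)
    (comul_rel R (φ := FreeAlgebra.lift k (v R S)) (γ := (grp R S).comp (MonoidHom.inl F G))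
      (by
        intro i y
        simpa [leftChar] using grp_v R S (y, 1) i)
      _ (by intro i; simp) (lift_v R S))
    (comul_rel S (φ := FreeAlgebra.lift k (w R S)) (γ := (grp R S).comp (MonoidHom.inr F G))
      (by
        intro i y
        have := w_grp R S (1, y) i
        simp only [map_one, one_mul, MonoidHom.one_apply] at this
        simp [rightChar, this, smul_smul])
      _ (by intro i; simp) (lift_w R S))

/-- The counit of `𝒟`. -/
def counitHom : Double R S →ₐ[k] k :=
  lift (fun _ => 0) (fun _ => 0) 1 (by simp) (by simp) (by simp) (by simp)
    R.counit_eq_zero S.counit_eq_zero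

theorem v_grp_inv (x : F × G) (i : I) : v R S i * grp R S x⁻¹ =
    ((τ₀ x.1 (g i) * τ₀ (f i) x.2 : kˣ) : k) • (grp R S x⁻¹ * v R S i) := by
  rw [grp_v, smul_smul, ← Units.val_mul]
  have : τ₀ x.1 (g i) * τ₀ (f i) x.2 * (τ₀ x⁻¹.1 (g i) * τ₀ (f i) x⁻¹.2) = 1 := by
    rw [Prod.fst_inv, Prod.snd_inv, map_inv τ₀, map_inv (τ₀ (f i)), MonoidHom.inv_apply,
      ← mul_inv, mul_inv_cancel]
  rw [this, Units.val_one, one_smul]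

theorem grp_inv_w (x : F × G) (i : I) : grp R S x⁻¹ * w R S i =
    ((τ₀ x.1 (g i) * τ₀ (f i) x.2 : kˣ) : k) • (w R S i * grp R S x⁻¹) := by
  rw [w_grp, smul_smul, ← Units.val_mul]
  have : τ₀ x.1 (g i) * τ₀ (f i) x.2 * (τ₀ x⁻¹.1 (g i) * τ₀ (f i) x⁻¹.2) = 1 := by
    rw [Prod.fst_inv, Prod.snd_inv, map_inv τ₀, map_inv (τ₀ (f i)), MonoidHom.inv_apply,
      ← mul_inv, mul_inv_cancel]
  rw [this, Units.val_one, one_smul]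

theorem anti_v_w (i j : I) :
    (grp R S (f i, 1)⁻¹ * v R S i) * (grp R S (1, g j)⁻¹ * w R S j) =
      (τ₀ (f i) (g j) : k) • (grp R S (f i, g j)⁻¹ * (v R S i * w R S j)) := by
  have e : grp R S (f i, g j)⁻¹ = grp R S (f i, 1)⁻¹ * grp R S (1, g j)⁻¹ := by
    rw [← map_mul]; simp
  have := v_grp_inv R S (1, g j) i
  simp only [map_one, one_mul, MonoidHom.one_apply] at this
  rw [mul_assoc, ← mul_assoc (v R S i), this, e]
  simp only [smul_mul_assoc, mul_smul_comm, mul_assoc]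

theorem anti_w_v (i j : I) :
    (τ₀ (f i) (g j) : k) • ((grp R S (1, g j)⁻¹ * w R S j) * (grp R S (f i, 1)⁻¹ * v R S i)) =
      grp R S (f i, g j)⁻¹ * (w R S j * v R S i) := by
  have e : grp R S (f i, g j)⁻¹ = grp R S (1, g j)⁻¹ * grp R S (f i, 1)⁻¹ := by
    rw [← map_mul]; simp
  have := grp_inv_w R S (f i, 1) j
  simp only [map_one, mul_one] at this
  rw [e, mul_assoc, mul_assoc, ← mul_assoc (grp R S (f i, 1)⁻¹), this]
  simp only [smul_mul_assoc, mul_smul_comm, mul_assoc]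

/-- The antipode of `𝒟`, as an algebra map to the opposite algebra. -/
def antipodeHom : Double R S →ₐ[k] (Double R S)ᵐᵒᵖ :=
  lift (fun i => MulOpposite.op (-(grp R S (f i, 1)⁻¹ * v R S i)))
    (fun i => MulOpposite.op (-(grp R S (1, g i)⁻¹ * w R S i)))
    (grpAntipode R S)
    (by
      intro x i
      apply MulOpposite.unop_injective
      simp only [grpAntipode_apply, MulOpposite.unop_mul, MulOpposite.unop_smul,
        MulOpposite.unop_op, neg_mul, mul_neg, smul_neg, mul_assoc, v_grp_inv, mul_smul_comm]
      rw [← mul_assoc, ← mul_assoc, ← map_mul, ← map_mul, mul_comm x⁻¹])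
    (by
      intro x i
      apply MulOpposite.unop_injective
      simp only [grpAntipode_apply, MulOpposite.unop_mul, MulOpposite.unop_smul,
        MulOpposite.unop_op, neg_mul, mul_neg, smul_neg]
      rw [← mul_assoc, ← map_mul, mul_comm x⁻¹, map_mul, mul_assoc, grp_inv_w, mul_smul_comm,
        mul_assoc])
    (by
      intro i
      apply MulOpposite.unop_injective
      simp only [grpAntipode_apply, MulOpposite.unop_mul, MulOpposite.unop_smul,
        MulOpposite.unop_op, MulOpposite.unop_add, MulOpposite.unop_sub, MulOpposite.unop_one,
        neg_mul, mul_neg, neg_neg, anti_v_w, anti_w_v, w_v_same, mul_add, mul_sub, mul_one,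
        mul_smul_comm, ← map_mul, inv_mul_cancel, map_one]
      abel)
    (by
      intro i j h
      apply MulOpposite.unop_injective
      simp only [MulOpposite.unop_mul, MulOpposite.unop_smul,
        MulOpposite.unop_op, neg_mul, mul_neg, neg_neg, anti_v_w, anti_w_v, w_v_ne R S i j h,
        mul_smul_comm])
    (antipode_rel R (φ := FreeAlgebra.lift k (v R S)) (γ := (grp R S).comp (MonoidHom.inl F G))
      (by
        intro i y
        simpa [leftChar] using grp_v R S (y, 1) i)
      _ (by intro i; simp) (lift_v R S))
    (antipode_rel S (φ := FreeAlgebra.lift k (w R S)) (γ := (grp R S).comp (MonoidHom.inr F G))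
      (by
        intro i y
        have := w_grp R S (1, y) i
        simp only [map_one, one_mul, MonoidHom.one_apply] at this
        simp [rightChar, this, smul_smul])
      _ (by intro i; simp) (lift_w R S))

@[simp] theorem comulHom_v (i : I) : comulHom R S (v R S i) =
    v R S i ⊗ₜ 1 + grp R S (f i, 1) ⊗ₜ v R S i := lift_apply_v i

@[simp] theorem comulHom_w (i : I) : comulHom R S (w R S i) =
    w R S i ⊗ₜ 1 + grp R S (1, g i) ⊗ₜ w R S i := lift_apply_w i

@[simp] theorem comulHom_grp (x : F × G) :
    comulHom R S (grp R S x) = grp R S x ⊗ₜ grp R S x := lift_apply_grp x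

@[simp] theorem counitHom_v (i : I) : counitHom R S (v R S i) = 0 := lift_apply_v i

@[simp] theorem counitHom_w (i : I) : counitHom R S (w R S i) = 0 := lift_apply_w i

@[simp] theorem counitHom_grp (x : F × G) : counitHom R S (grp R S x) = 1 := lift_apply_grp x

theorem antipodeHom_v (i : I) : antipodeHom R S (v R S i) =
    MulOpposite.op (-(grp R S (f i, 1)⁻¹ * v R S i)) := lift_apply_v i

theorem antipodeHom_w (i : I) : antipodeHom R S (w R S i) =
    MulOpposite.op (-(grp R S (1, g i)⁻¹ * w R S i)) := lift_apply_w i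

theorem antipodeHom_grp (x : F × G) :
    antipodeHom R S (grp R S x) = MulOpposite.op (grp R S x⁻¹) := lift_apply_grp x

instance : Bialgebra k (Double R S) :=
  Bialgebra.ofAlgHom (comulHom R S) (counitHom R S)
    (by
      apply algHom_ext <;> intro i <;>
      simp [TensorProduct.tmul_add, TensorProduct.add_tmul,
        Algebra.TensorProduct.one_def, add_assoc])
    (by
      apply algHom_ext <;> intro i <;>
      simp)
    (by
      apply algHom_ext <;> intro i <;>
      simp)

/-- The antipode of `𝒟`, as a linear map. -/
def antipodeLin : Double R S →ₗ[k] Double R S :=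
  (MulOpposite.opLinearEquiv k).symm.toLinearMap ∘ₗ (antipodeHom R S).toLinearMap

theorem antipodeLin_apply (a : Double R S) :
    antipodeLin R S a = (antipodeHom R S a).unop := rfl

theorem antipodeLin_mul (a b : Double R S) :
    antipodeLin R S (a * b) = antipodeLin R S b * antipodeLin R S a := by
  simp [antipodeLin_apply]

variable {R S} in
theorem induction {p : Double R S → Prop} (hk : ∀ r : k, p (algebraMap k _ r))
    (hv : ∀ i, p (v R S i)) (hw : ∀ i, p (w R S i)) (hg : ∀ x, p (grp R S x))
    (hadd : ∀ a b, p a → p b → p (a + b)) (hmul : ∀ a b, p a → p b → p (a * b))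
    (a : Double R S) : p a := by
  obtain ⟨a, rfl⟩ : ∃ b, mk R S b = a := RingQuot.mkAlgHom_surjective k _ a
  induction a using FreeAlgebra.induction with
  | grade0 r => rw [AlgHom.commutes]; exact hk r
  | grade1 y =>
    cases y with
    | v i => exact hv i
    | w i => exact hw i
    | grp x => exact hg x
  | mul a b ha hb => rw [map_mul]; exact hmul _ _ ha hb
  | add a b ha hb => rw [map_add]; exact hadd _ _ ha hb

theorem antipode_left (a : Double R S) :
    LinearMap.mul' k _ ((antipodeLin R S).rTensor _ (comulHom R S a)) =
      algebraMap k _ (counitHom R S a) := by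
  induction a using induction with
  | hk r => simp [Algebra.TensorProduct.algebraMap_apply, antipodeLin_apply]
  | hv i => simp [antipodeLin_apply, antipodeHom_v, antipodeHom_grp]
  | hw i => simp [antipodeLin_apply, antipodeHom_w, antipodeHom_grp]
  | hg x => simp [antipodeLin_apply, antipodeHom_grp, ← map_mul]
  | hadd a b ha hb => simp only [map_add, ha, hb]
  | hmul a b ha hb =>
    have key : ∀ s t : Double R S ⊗[k] Double R S,
        ∀ c, LinearMap.mul' k _ ((antipodeLin R S).rTensor _ s) = algebraMap k _ c →
        LinearMap.mul' k _ ((antipodeLin R S).rTensor _ (s * t)) =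
          c • LinearMap.mul' k _ ((antipodeLin R S).rTensor _ t) := by
      intro s t c hs
      induction t with
      | zero => simp
      | add t t' ht ht' => simp only [mul_add, map_add, ht, ht', smul_add]
      | tmul y z =>
        have : ∀ s : Double R S ⊗[k] Double R S,
            LinearMap.mul' k _ ((antipodeLin R S).rTensor _ (s * (y ⊗ₜ z))) =
            antipodeLin R S y * LinearMap.mul' k _ ((antipodeLin R S).rTensor _ s) * z := by
          intro s
          induction s with
          | zero => simp
          | add t t' ht ht' => simp only [mul_add, add_mul, map_add, ht, ht']
          | tmul y' z' => simp [antipodeLin_mul, mul_assoc]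
        rw [this, hs, ← Algebra.commutes, mul_assoc]
        simp [Algebra.smul_def]
    rw [map_mul, key _ _ _ ha, hb, map_mul, map_mul, Algebra.smul_def]

theorem antipode_right (a : Double R S) :
    LinearMap.mul' k _ ((antipodeLin R S).lTensor _ (comulHom R S a)) =
      algebraMap k _ (counitHom R S a) := by
  induction a using induction with
  | hk r => simp [Algebra.TensorProduct.algebraMap_apply, antipodeLin_apply]
  | hv i => simp [antipodeLin_apply, antipodeHom_v, ← mul_assoc, ← map_mul, ← Prod.one_eq_mk]
  | hw i => simp [antipodeLin_apply, antipodeHom_w, ← mul_assoc, ← map_mul, ← Prod.one_eq_mk]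
  | hg x => simp [antipodeLin_apply, antipodeHom_grp, ← map_mul]
  | hadd a b ha hb => simp only [map_add, ha, hb]
  | hmul a b ha hb =>
    have key : ∀ s t : Double R S ⊗[k] Double R S,
        ∀ c, LinearMap.mul' k _ ((antipodeLin R S).lTensor _ t) = algebraMap k _ c →
        LinearMap.mul' k _ ((antipodeLin R S).lTensor _ (s * t)) =
          c • LinearMap.mul' k _ ((antipodeLin R S).lTensor _ s) := by
      intro s t c ht
      induction s with
      | zero => simp
      | add s s' hs hs' => simp only [add_mul, map_add, hs, hs', smul_add]
      | tmul y z =>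
        have : ∀ t : Double R S ⊗[k] Double R S,
            LinearMap.mul' k _ ((antipodeLin R S).lTensor _ ((y ⊗ₜ z) * t)) =
            y * LinearMap.mul' k _ ((antipodeLin R S).lTensor _ t) * antipodeLin R S z := by
          intro t
          induction t with
          | zero => simp
          | add t t' ht ht' => simp only [mul_add, add_mul, map_add, ht, ht']
          | tmul y' z' => simp [antipodeLin_mul, mul_assoc]
        rw [this, ht, ← Algebra.commutes, mul_assoc]
        simp [Algebra.smul_def]
    rw [map_mul, key _ _ _ hb, ha, map_mul, mul_comm, map_mul, Algebra.smul_def]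

instance : HopfAlgebra k (Double R S) where
  antipode := antipodeLin R S
  mul_antipode_rTensor_comul := LinearMap.ext (antipode_left R S)
  mul_antipode_lTensor_comul := LinearMap.ext (antipode_right R S)

/-- The two-sided ideal of `𝒟` generated by all `t - 1`, `t ∈ T`. -/
def groupIdeal (T : Subgroup (F × G)) : Ideal (Double R S) :=
  (TwoSidedIdeal.span ((fun t => grp R S t - 1) '' (T : Set (F × G)))).asIdeal

instance (T : Subgroup (F × G)) : (groupIdeal R S T).IsTwoSided := by
  unfold groupIdeal; infer_instance

variable {R S} in
theorem groupIdeal_induction {T : Subgroup (F × G)} {A : Type x} [Ring A] [Algebra k A]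
    (α : Double R S →ₐ[k] A) (h : ∀ t ∈ T, α (grp R S t) = 1) {a : Double R S}
    (ha : a ∈ groupIdeal R S T) : α a = 0 := by
  have : TwoSidedIdeal.span ((fun t => grp R S t - 1) '' (T : Set (F × G))) ≤
      TwoSidedIdeal.ker α := by
    rw [TwoSidedIdeal.span_le]
    rintro _ ⟨t, ht, rfl⟩
    simp [TwoSidedIdeal.mem_ker, h t ht]
  exact (TwoSidedIdeal.mem_ker α).1 (this ha)

variable {R S} in
theorem grp_sub_one_mem {T : Subgroup (F × G)} {t : F × G} (ht : t ∈ T) :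
    grp R S t - 1 ∈ groupIdeal R S T :=
  TwoSidedIdeal.subset_span ⟨t, ht, rfl⟩

theorem mk_grp {T : Subgroup (F × G)} {t : F × G} (ht : t ∈ T) :
    Ideal.Quotient.mkₐ k (groupIdeal R S T) (grp R S t) = 1 := by
  have := Ideal.Quotient.eq_zero_iff_mem.2 (grp_sub_one_mem (R := R) (S := S) ht)
  rw [map_sub, map_one, sub_eq_zero] at this
  exact this

/-- The ideal generated by all `t - 1`, `t ∈ T`, is a Hopf ideal, so `𝒟 ⧸ groupIdeal R S T` is a
Hopf algebra. -/
instance (T : Subgroup (F × G)) : (groupIdeal R S T).IsHopfIdeal k where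
  counit_eq_zero a ha :=
    groupIdeal_induction (counitHom R S) (fun t _ => counitHom_grp R S t) ha
  map_mkQ_comul_eq_zero a ha :=
    groupIdeal_induction ((Algebra.TensorProduct.map (Ideal.Quotient.mkₐ k (groupIdeal R S T))
      (Ideal.Quotient.mkₐ k (groupIdeal R S T))).comp (comulHom R S)) (fun t ht => by
        rw [AlgHom.comp_apply, comulHom_grp, Algebra.TensorProduct.map_tmul, mk_grp R S ht]
        rfl) ha
  antipode_mem a ha := by
    have := groupIdeal_induction ((AlgHom.op (Ideal.Quotient.mkₐ k (groupIdeal R S T))).comp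
      (antipodeHom R S)) (fun t ht => by
        rw [AlgHom.comp_apply, antipodeHom_grp]
        apply MulOpposite.unop_injective
        exact mk_grp R S (T.inv_mem ht)) ha
    exact Ideal.Quotient.eq_zero_iff_mem.1 (congrArg MulOpposite.unop this)

/-- The map of Hopf algebras `kT → 𝒟` given by a subgroup `T ⊆ F × G`. -/
def groupIncl (T : Subgroup (F × G)) : MonoidAlgebra k T →ₐc[k] Double R S :=
  .ofAlgHom (MonoidAlgebra.lift k (Double R S) T ((grp R S).comp T.subtype))
    (by
      ext t
      simp only [MonoidHom.coe_comp, Function.comp_apply, AlgHom.comp_apply,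
        MonoidAlgebra.lift_single, one_smul]
      exact (counitHom_grp R S t).trans (by simp))
    (by
      ext t
      simp only [MonoidHom.coe_comp, Function.comp_apply, AlgHom.comp_apply,
        MonoidAlgebra.lift_single, one_smul]
      refine Eq.trans ?_ (comulHom_grp R S t).symm
      simp)

/-- `𝒟` as a right comodule over `𝒟 / (t - 1 ∣ t ∈ T)`: `a ↦ a₁ ⊗ ā₂`. -/
def coactRight (T : Subgroup (F × G)) :
    Double R S →ₗ[k] Double R S ⊗[k] (Double R S ⧸ groupIdeal R S T) :=
  (Ideal.Quotient.mkₐ k (groupIdeal R S T)).toLinearMap.lTensor (Double R S) ∘ₗ Coalgebra.comul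

/-- `𝒟` as a left comodule over `𝒟 / (t - 1 ∣ t ∈ T)`: `a ↦ ā₁ ⊗ a₂`. -/
def coactLeft (T : Subgroup (F × G)) :
    Double R S →ₗ[k] (Double R S ⧸ groupIdeal R S T) ⊗[k] Double R S :=
  (Ideal.Quotient.mkₐ k (groupIdeal R S T)).toLinearMap.rTensor (Double R S) ∘ₗ Coalgebra.comul

end Double

/-- `L ⊗ Q` as a right comodule over the coalgebra `Q`: `c ⊗ x ↦ (c ⊗ x₁) ⊗ x₂`. -/
def freeCoactRight (k : Type u) [Field k] (L Q : Type*) [AddCommGroup L] [Module k L]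
    [AddCommGroup Q] [Module k Q] [Coalgebra k Q] : L ⊗[k] Q →ₗ[k] (L ⊗[k] Q) ⊗[k] Q :=
  (TensorProduct.assoc k L Q Q).symm.toLinearMap ∘ₗ Coalgebra.comul.lTensor L

/-- `L ⊗ Q` as a left comodule over the coalgebra `Q`: `c ⊗ x ↦ x₁ ⊗ (c ⊗ x₂)`. -/
def freeCoactLeft (k : Type u) [Field k] (L Q : Type*) [AddCommGroup L] [Module k L]
    [AddCommGroup Q] [Module k Q] [Coalgebra k Q] : L ⊗[k] Q →ₗ[k] Q ⊗[k] (L ⊗[k] Q) :=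
  (TensorProduct.leftComm k L Q Q).toLinearMap ∘ₗ Coalgebra.comul.lTensor L

/-- The subgroup `C = {(a, b) ∣ τ₀(a, g_i) τ₀(f_i, b) = 1 for all i}` of central grouplikes. -/
def centralSubgroup (τ₀ : F →* G →* kˣ) (f : I → F) (g : I → G) : Subgroup (F × G) where
  carrier := {x | ∀ i, τ₀ x.1 (g i) * τ₀ (f i) x.2 = 1}
  one_mem' := by simp
  mul_mem' {x y} hx hy i := by
    have : τ₀ (x * y).1 (g i) * τ₀ (f i) (x * y).2 =
        (τ₀ x.1 (g i) * τ₀ (f i) x.2) * (τ₀ y.1 (g i) * τ₀ (f i) y.2) := by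
      simp [mul_mul_mul_comm]
    rw [this, hx, hy, one_mul]
  inv_mem' {x} hx i := by
    have : τ₀ x⁻¹.1 (g i) * τ₀ (f i) x⁻¹.2 = (τ₀ x.1 (g i) * τ₀ (f i) x.2)⁻¹ := by
      simp [mul_comm]
    rw [this, hx, inv_one]

/-- The subgroup `P` of `F × G` generated by all `f_i g_i`. -/
def pairSubgroup (f : I → F) (g : I → G) : Subgroup (F × G) :=
  Subgroup.closure (Set.range fun i => (f i, g i))

/-- Non-degeneracy of a bimultiplicative map. -/
def Nondegenerate (τ₀ : F →* G →* kˣ) : Prop :=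
  (∀ a, (∀ b, τ₀ a b = 1) → a = 1) ∧ ∀ b, (∀ a, τ₀ a b = 1) → b = 1

/-- The subgroup `{(g, g⁻¹)}` of `G × G`. -/
def antidiagonal (G : Type w) [CommGroup G] : Subgroup (G × G) where
  carrier := {x | x.2 = x.1⁻¹}
  one_mem' := by simp
  mul_mem' {x y} hx hy := by
    simp only [Set.mem_ofPred_eq] at *
    simp [hx, hy, mul_comm]
  inv_mem' {x} hx := by
    simp only [Set.mem_ofPred_eq] at *
    simp [hx]

/-- The two-sided ideal of `𝒟` (in the case `F = G`) generated by the elements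
`f_i ⊗ 1 - 1 ⊗ f_i`. -/
def flipIdeal {τ₀ : G →* G →* kˣ} {f g : I → G} (R : PreNichols (leftChar τ₀ g) f)
    (S : PreNichols (rightChar τ₀ f) g) : Ideal (Double R S) :=
  (TwoSidedIdeal.span
    (Set.range fun i => Double.grp R S (f i, 1) - Double.grp R S (1, f i))).asIdeal

end Double

/-! ### Cartan matrices of finite type -/

section Cartan

variable {I : Type v}

/-- The graph underlying the Dynkin diagram of `A`. -/
def dynkinGraph (A : Matrix I I ℤ) : SimpleGraph I where
  Adj i j := i ≠ j ∧ (A i j ≠ 0 ∨ A j i ≠ 0)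
  symm := ⟨fun _ _ h => ⟨h.1.symm, h.2.symm⟩⟩
  loopless := ⟨fun _ h => h.1 rfl⟩

/-- The irreducible component `c` of `A` equals the matrix `X` up to a relabelling. -/
def HasType (A : Matrix I I ℤ) (c : (dynkinGraph A).ConnectedComponent) {n : ℕ}
    (X : Matrix (Fin n) (Fin n) ℤ) : Prop :=
  ∃ e : Fin n ≃ c.supp, ∀ a b, A (e a) (e b) = X a b

/-- `A` is a Cartan matrix of finite type: each of its irreducible components is one of the Cartan
matrices of types `A_n`, `B_n`, `C_n`, `D_n`, `E₆`, `E₇`, `E₈`, `F₄`, `G₂`. -/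
def IsFiniteType (A : Matrix I I ℤ) : Prop :=
  ∀ c : (dynkinGraph A).ConnectedComponent,
    (∃ n, 1 ≤ n ∧ HasType A c (CartanMatrix.A n)) ∨
    (∃ n, 2 ≤ n ∧ HasType A c (CartanMatrix.B n)) ∨
    (∃ n, 3 ≤ n ∧ HasType A c (CartanMatrix.C n)) ∨
    (∃ n, 4 ≤ n ∧ HasType A c (CartanMatrix.D n)) ∨
    HasType A c CartanMatrix.E₆ ∨ HasType A c CartanMatrix.E₇ ∨ HasType A c CartanMatrix.E₈ ∨
    HasType A c CartanMatrix.F₄ ∨ HasType A c CartanMatrix.G₂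

/-- `diag(d_i)` is the standard symmetrization of `A`: the `d_i` lie in `{1, 2, 3}`, the matrix
`(d_i a_{ij})` is symmetric, and `d_i = 1` for some `i` in each irreducible component. -/
structure IsStandardSymmetrizer (A : Matrix I I ℤ) (d : I → ℕ) : Prop where
  mem (i : I) : d i = 1 ∨ d i = 2 ∨ d i = 3
  symm (i j : I) : (d i : ℤ) * A i j = d j * A j i
  exists_eq_one (c : (dynkinGraph A).ConnectedComponent) : ∃ i ∈ c.supp, d i = 1

/-- The finite abelian group generated by `K_i` (`i ∈ I`) with relations `K_i ^ l = 1`. -/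
abbrev KGroup (I : Type v) (l : ℕ) : Type v := I → Multiplicative (ZMod l)

/-- The generator `K_i`. -/
def K {I : Type v} [DecidableEq I] (l : ℕ) (i : I) : KGroup I l :=
  Pi.mulSingle i (Multiplicative.ofAdd 1)

end Cartan

end GQD

end

noncomputable section

namespace GQD

universe u v w

/-! ### Determinants of the Cartan matrices -/

/-! All the equivalences pass through the radical of `τ₀`, the set of `a` with `τ₀ a (K l j) = 1`
for all `j`. Since `d_i a_ij` is symmetric, so is `τ₀`, and `C` is the preimage of the radical under
multiplication `G × G → G`, while `T` is the kernel of that multiplication. Hence `T = C` exactly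
when the radical is trivial. `P` is the diagonal, and `(a, a)` lies in `C` exactly when `a²` lies in
the radical; as `l` is odd, squaring is injective, so `C ∩ P` is trivial under the same condition.
Non-degeneracy says the same because the `K_i` generate `G`.

In coordinates `G` is `(ℤ/l)^I` and the form is the matrix `-DA` modulo `l`, so a trivial radical
means that `det D · det A` is a unit modulo `l` (`radical_eq_bot_iff`). The `d_i` are prime to `l`:
the value `2` is excluded by oddness, and `3` occurs only in components of type `G₂`. Finally `det
A` is the product over the components of `n + 1, 2, 2, 4, 3, 2, 1, 1, 1` for the types `A, B, C, D,
E₆, E₇, E₈, F₄, G₂`, and for odd `l` only `A_n` and `E₆` can share a factor with it.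

For the splitting, `(a, b) ↦ (h, h⁻¹)` with `h² = a b⁻¹` is a retraction of `G × G` onto `T` that
kills `P`. Killing `P` is what the cross relation demands, so the retraction extends by zero on
`v_i`, `w_i` to a Hopf map `π : 𝒟 → kC`. Then `a ↦ π(a₁) ⊗ ā₂` is an algebra map with inverse `c ⊗ ā
↦ c π(a₁)⁻¹ a₂`, which is multiplicative because `kC` is central (`splitHom_bijective`). All
identities are between algebra maps, so they are checked on generators and no basis of `𝒟` is
needed. The opposite coproduct gives the left-handed version. -/

theorem det_eq_of_leaf {R : Type*} [CommRing R] {n : ℕ} (M : Matrix (Fin (n + 2)) (Fin (n + 2)) R)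
    (hrow : ∀ j : Fin n, M 0 j.succ.succ = 0) (hcol : ∀ i : Fin n, M i.succ.succ 0 = 0) :
    M.det = M 0 0 * (M.submatrix Fin.succ Fin.succ).det -
      M 0 1 * M 1 0 * (M.submatrix (Fin.succ ∘ Fin.succ) (Fin.succ ∘ Fin.succ)).det := by
  -- The second minor in the expansion along row `0` still has column `0` of `M` as its first
  -- column, and only its top entry `M 1 0` survives.
  have hminor : (M.submatrix Fin.succ (Fin.succAbove 1)).det =
      M 1 0 * (M.submatrix (Fin.succ ∘ Fin.succ) (Fin.succ ∘ Fin.succ)).det := by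
    rw [Matrix.det_succ_column_zero, Fin.sum_univ_succ, Finset.sum_eq_zero]
    · have : (Fin.succAbove 1 : Fin (n + 1) → Fin (n + 2)) ∘ Fin.succ = Fin.succ ∘ Fin.succ := by
        funext j
        simp only [Function.comp_apply]
        rw [← Fin.succ_zero_eq_one, Fin.succ_succAbove_succ, Fin.succAbove_zero]
      simp [Matrix.submatrix_submatrix, this]
    · intro i _
      simp [hcol]
  rw [Matrix.det_succ_row_zero, Fin.sum_univ_succ, Fin.sum_univ_succ, Finset.sum_eq_zero]
  · simp [hminor]
    ring
  · intro j _
    simp [hrow]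

theorem det_cartan_A (n : ℕ) : (CartanMatrix.A n).det = n + 1 := by
  induction n using Nat.twoStepInduction with
  | zero => simp
  | one => simp [CartanMatrix.A]
  | more n h0 h1 =>
    have e1 : (CartanMatrix.A (n + 2)).submatrix Fin.succ Fin.succ = CartanMatrix.A (n + 1) := by
      ext i j; simp [CartanMatrix.A]
    have e2 : (CartanMatrix.A (n + 2)).submatrix (Fin.succ ∘ Fin.succ) (Fin.succ ∘ Fin.succ) =
        CartanMatrix.A n := by
      ext i j; simp [CartanMatrix.A]
    rw [det_eq_of_leaf _ (fun j => by simp [CartanMatrix.A, Fin.ext_iff])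
      (fun j => by simp [CartanMatrix.A, Fin.ext_iff]), e1, e2, h0, h1]
    simp [CartanMatrix.A]
    ring

/-- The double bond is at the far end, so deleting the first nodes stays in the family and the
recursion reads `2 · 2 - 2 = 2`. The rank is shifted because the empty matrix has determinant `1`.
-/
theorem det_cartan_B (n : ℕ) : (CartanMatrix.B (n + 1)).det = 2 := by
  induction n using Nat.twoStepInduction with
  | zero => simp
  | one => rw [CartanMatrix.B_two, Matrix.det_fin_two]; simp
  | more n h0 h1 =>
    have e1 : (CartanMatrix.B (n + 3)).submatrix Fin.succ Fin.succ = CartanMatrix.B (n + 2) := by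
      ext i j; simp [CartanMatrix.B]
    have e2 : (CartanMatrix.B (n + 3)).submatrix (Fin.succ ∘ Fin.succ) (Fin.succ ∘ Fin.succ) =
        CartanMatrix.B (n + 1) := by
      ext i j; simp [CartanMatrix.B]
    rw [det_eq_of_leaf _ (fun j => ?_) (fun j => ?_), e1, e2, h0, h1]
    · simp [CartanMatrix.B]
    · simp only [CartanMatrix.B, Matrix.of_apply, Fin.ext_iff, Fin.val_succ, Fin.val_zero]
      split_ifs <;> first | contradiction | omega
    · simp only [CartanMatrix.B, Matrix.of_apply, Fin.ext_iff, Fin.val_succ, Fin.val_zero]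
      split_ifs <;> first | rfl | contradiction

theorem det_cartan_C (n : ℕ) : (CartanMatrix.C (n + 1)).det = 2 := by
  rw [← CartanMatrix.B_transpose, Matrix.det_transpose, det_cartan_B]

/-- The fork is at the far end. The value `4` is already correct at the degenerate ranks `2` and
`3`, from which the recursion `2 · 4 - 4` starts. -/
theorem det_cartan_D (n : ℕ) : (CartanMatrix.D (n + 2)).det = 4 := by
  induction n using Nat.twoStepInduction with
  | zero => rw [CartanMatrix.D_two, Matrix.det_fin_two]; simp
  | one => rw [CartanMatrix.D_three, Matrix.det_fin_three]; simp
  | more n h0 h1 =>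
    have e1 : (CartanMatrix.D (n + 4)).submatrix Fin.succ Fin.succ = CartanMatrix.D (n + 3) := by
      ext i j
      simp only [CartanMatrix.D, Matrix.submatrix_apply, Matrix.of_apply, Fin.succ_inj,
        Fin.val_succ]
      split_ifs <;> omega
    have e2 : (CartanMatrix.D (n + 4)).submatrix (Fin.succ ∘ Fin.succ) (Fin.succ ∘ Fin.succ) =
        CartanMatrix.D (n + 2) := by
      ext i j
      simp only [CartanMatrix.D, Matrix.submatrix_apply, Matrix.of_apply, Fin.succ_inj,
        Fin.val_succ, Function.comp_apply]
      split_ifs <;> first | rfl | omega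
    rw [det_eq_of_leaf _ (fun j => ?_) (fun j => ?_), e1, e2, h0, h1]
    · simp [CartanMatrix.D]
    · simp only [CartanMatrix.D, Matrix.of_apply, Fin.ext_iff, Fin.val_succ, Fin.val_zero]
      split_ifs <;> first | rfl | omega | tauto
    · simp only [CartanMatrix.D, Matrix.of_apply, Fin.ext_iff, Fin.val_succ, Fin.val_zero]
      split_ifs <;> first | rfl | omega | tauto

/-! ### Irreducible components -/

section Components

variable {I : Type v}

theorem apply_eq_zero_of_not_adj {A : Matrix I I ℤ} {i j : I} (hij : i ≠ j)
    (h : ¬ (dynkinGraph A).Adj i j) : A i j = 0 := by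
  by_contra h0
  exact h ⟨hij, .inl h0⟩

/-- The determinant is the product of the determinants of the irreducible components. -/
theorem det_eq_prod_components [Fintype I] [DecidableEq I] (A : Matrix I I ℤ)
    [Fintype (dynkinGraph A).ConnectedComponent]
    [∀ c : (dynkinGraph A).ConnectedComponent, Fintype c.supp] :
    A.det = ∏ c : (dynkinGraph A).ConnectedComponent,
      (A.submatrix ((↑) : c.supp → I) ((↑) : c.supp → I)).det := by
  classical
  -- Entries between distinct components vanish, so `A` is block triangular for any order on the
  -- components; an arbitrary one is chosen.
  let _ : LinearOrder (dynkinGraph A).ConnectedComponent :=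
    LinearOrder.lift' _ (Fintype.equivFin _).injective
  have hA : A.BlockTriangular (dynkinGraph A).connectedComponentMk := by
    intro i j hij
    refine apply_eq_zero_of_not_adj (by rintro rfl; exact hij.false) fun hadj => hij.ne' ?_
    exact SimpleGraph.ConnectedComponent.eq.2 hadj.reachable
  rw [hA.det_fintype]
  refine Finset.prod_congr rfl fun c _ => ?_
  rw [← Matrix.det_submatrix_equiv_self (Equiv.subtypeEquivRight fun _ => Iff.rfl :
    c.supp ≃ {i // (dynkinGraph A).connectedComponentMk i = c})]
  rfl

theorem HasType.det_eq {A : Matrix I I ℤ} [DecidableEq I] {c : (dynkinGraph A).ConnectedComponent}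
    [Fintype c.supp] {n : ℕ} {X : Matrix (Fin n) (Fin n) ℤ} (h : HasType A c X) :
    (A.submatrix ((↑) : c.supp → I) ((↑) : c.supp → I)).det = X.det := by
  obtain ⟨e, he⟩ := h
  rw [← Matrix.det_submatrix_equiv_self e]
  congr 1
  ext a b
  exact he a b

/-- Among the possible determinants, oddness of `l` disposes of `2` and `4`, leaving `n + 1` for
`A_n` and `3` for `E₆` as the only obstructions. -/
theorem det_component_coprime_iff [DecidableEq I] {A : Matrix I I ℤ} (hA : IsFiniteType A)
    {l : ℕ} (hodd : Odd l) (c : (dynkinGraph A).ConnectedComponent) [Fintype c.supp] :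
    IsCoprime (l : ℤ) (A.submatrix ((↑) : c.supp → I) ((↑) : c.supp → I)).det ↔
      (∀ n : ℕ, HasType A c (CartanMatrix.A n) → Nat.Coprime (n + 1) l) ∧
        (3 ∣ l → ¬ HasType A c CartanMatrix.E₆) := by
  have h2 : IsCoprime (l : ℤ) 2 := by
    rw [show (2 : ℤ) = ((2 : ℕ) : ℤ) from rfl, Nat.isCoprime_iff_coprime]
    exact hodd.coprime_two_right
  have h4 : IsCoprime (l : ℤ) 4 := by
    rw [show (4 : ℤ) = 2 * 2 from rfl]
    exact h2.mul_right h2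
  have h3 : IsCoprime (l : ℤ) 3 ↔ ¬ 3 ∣ l := by
    rw [show (3 : ℤ) = ((3 : ℕ) : ℤ) from rfl, Nat.isCoprime_iff_coprime, Nat.coprime_comm,
      Nat.Prime.coprime_iff_not_dvd Nat.prime_three]
  constructor
  · intro h
    constructor
    · intro n hn
      rw [hn.det_eq, det_cartan_A] at h
      rw [Nat.coprime_comm, ← Nat.isCoprime_iff_coprime]
      exact_mod_cast h
    · intro hl hE
      rw [hE.det_eq, CartanMatrix.E₆_det, h3] at h
      exact h hl
  · rintro ⟨hAn, hE⟩
    rcases hA c with ⟨n, -, h⟩ | ⟨n, hn, h⟩ | ⟨n, hn, h⟩ | ⟨n, hn, h⟩ | h | h | h | h | h <;>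
      rw [h.det_eq]
    · rw [det_cartan_A]
      have := hAn n h
      rw [Nat.coprime_comm, ← Nat.isCoprime_iff_coprime] at this
      exact_mod_cast this
    · obtain ⟨n, rfl⟩ := Nat.exists_eq_add_of_le' (show 1 ≤ n by omega)
      rwa [det_cartan_B]
    · obtain ⟨n, rfl⟩ := Nat.exists_eq_add_of_le' (show 1 ≤ n by omega)
      rwa [det_cartan_C]
    · obtain ⟨n, rfl⟩ := Nat.exists_eq_add_of_le' (show 2 ≤ n by omega)
      rwa [det_cartan_D]
    · rw [CartanMatrix.E₆_det, h3]
      exact fun hl => hE hl h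
    · rwa [CartanMatrix.E₇_det]
    · rw [CartanMatrix.E₈_det]; exact isCoprime_one_right
    · rw [CartanMatrix.F₄_det]; exact isCoprime_one_right
    · rw [CartanMatrix.G₂_det]; exact isCoprime_one_right

/-- The explicit form of the condition that `l` is prime to `det A`. -/
theorem coprime_det_iff [Fintype I] [DecidableEq I] {A : Matrix I I ℤ} (hA : IsFiniteType A)
    {l : ℕ} (hodd : Odd l) :
    IsCoprime (l : ℤ) A.det ↔ ∀ c : (dynkinGraph A).ConnectedComponent,
      (∀ n : ℕ, HasType A c (CartanMatrix.A n) → Nat.Coprime (n + 1) l) ∧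
        (3 ∣ l → ¬ HasType A c CartanMatrix.E₆) := by
  classical
  have : Fintype (dynkinGraph A).ConnectedComponent := Fintype.ofFinite _
  rw [det_eq_prod_components, IsCoprime.prod_right_iff]
  simp only [Finset.mem_univ, true_implies, det_component_coprime_iff hA hodd]

/-- In a component of finite type other than `G₂`, no nonzero entry is divisible by `3`. -/
theorem not_three_dvd_of_hasType_ne_G₂ {A : Matrix I I ℤ} (hA : IsFiniteType A)
    {c : (dynkinGraph A).ConnectedComponent} (hG₂ : ¬ HasType A c CartanMatrix.G₂)
    {i j : I} (hi : i ∈ c.supp) (hj : j ∈ c.supp) (hij : A i j ≠ 0) : ¬ 3 ∣ A i j := by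
  suffices h : A i j = 2 ∨ A i j = -1 ∨ A i j = -2 by omega
  have aux : ∀ {n : ℕ} {X : Matrix (Fin n) (Fin n) ℤ}, HasType A c X →
      (∀ a b, X a b ≠ 0 → X a b = 2 ∨ X a b = -1 ∨ X a b = -2) →
      A i j = 2 ∨ A i j = -1 ∨ A i j = -2 := by
    rintro n X ⟨e, he⟩ hX
    have := he (e.symm ⟨i, hi⟩) (e.symm ⟨j, hj⟩)
    simp only [Equiv.apply_symm_apply] at this
    rw [this] at hij ⊢
    exact hX _ _ hij
  rcases hA c with ⟨n, -, h⟩ | ⟨n, hn, h⟩ | ⟨n, hn, h⟩ | ⟨n, hn, h⟩ | h | h | h | h | h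
  · refine aux h fun a b => ?_
    simp only [CartanMatrix.A, Matrix.of_apply]
    split_ifs <;> simp
  · refine aux h fun a b => ?_
    simp only [CartanMatrix.B, Matrix.of_apply]
    split_ifs <;> simp
  · refine aux h fun a b => ?_
    simp only [CartanMatrix.C, Matrix.of_apply]
    split_ifs <;> simp
  · refine aux h fun a b => ?_
    simp only [CartanMatrix.D, Matrix.of_apply]
    split_ifs <;> simp
  · exact aux h fun a b => by fin_cases a <;> fin_cases b <;> simp [CartanMatrix.E₆]
  · exact aux h fun a b => by fin_cases a <;> fin_cases b <;> simp [CartanMatrix.E₇]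
  · exact aux h fun a b => by fin_cases a <;> fin_cases b <;> simp [CartanMatrix.E₈]
  · exact aux h fun a b => by fin_cases a <;> fin_cases b <;> simp [CartanMatrix.F₄]
  · exact absurd h hG₂

/-- The only delicate case is `d i = 3` outside type `G₂`. There `d_a a_{aa'} = d_{a'} a_{a'a}` with
`3 ∤ a_{a'a}` propagates divisibility of `d` by `3` along each edge, hence to a vertex of the
component where `d = 1`, which is absurd. -/
theorem IsStandardSymmetrizer.coprime {A : Matrix I I ℤ} (hA : IsFiniteType A) {d : I → ℕ}
    (hd : IsStandardSymmetrizer A d) {l : ℕ} (hodd : Odd l)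
    (hG₂ : ∀ c : (dynkinGraph A).ConnectedComponent, HasType A c CartanMatrix.G₂ → ¬ 3 ∣ l)
    (i : I) : Nat.Coprime (d i) l := by
  rcases hd.mem i with h | h | h
  · simp [h]
  · rw [h]; exact hodd.coprime_two_left
  · rw [h, Nat.Prime.coprime_iff_not_dvd Nat.prime_three]
    set c := (dynkinGraph A).connectedComponentMk i
    by_cases hc : HasType A c CartanMatrix.G₂
    · exact hG₂ c hc
    exfalso
    obtain ⟨j, hj, hdj⟩ := hd.exists_eq_one c
    have hreach : (dynkinGraph A).Reachable i j :=
      (SimpleGraph.ConnectedComponent.eq.1 hj).symm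
    suffices H : ∀ {a b : I}, (dynkinGraph A).Walk a b → a ∈ c.supp → 3 ∣ d a → 3 ∣ d b by
      have := H hreach.some rfl (by rw [h])
      omega
    intro a b p
    induction p with
    | nil => exact fun _ h => h
    | @cons a a' b hadj p ih =>
      intro ha hda
      have ha' : a' ∈ c.supp := by
        rw [SimpleGraph.ConnectedComponent.mem_supp_iff] at ha ⊢
        rw [← ha, SimpleGraph.ConnectedComponent.eq]
        exact hadj.reachable.symm
      refine ih ha' ?_
      have hda0 : ∀ i, (d i : ℤ) ≠ 0 := fun i => by
        rcases hd.mem i with h | h | h <;> simp [h]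
      have hsymm := hd.symm a a'
      have hne : A a' a ≠ 0 := by
        rcases hadj.2 with h | h
        · intro h0
          rw [h0, mul_zero] at hsymm
          exact (mul_ne_zero (hda0 a) h) hsymm
        · exact h
      have h3 : (3 : ℤ) ∣ d a' * A a' a := by
        rw [← hsymm]
        exact Dvd.dvd.mul_right (by exact_mod_cast hda) _
      rcases (Int.prime_three.dvd_mul).1 h3 with h | h
      · exact_mod_cast h
      · exact absurd h (not_three_dvd_of_hasType_ne_G₂ hA hc ha' ha hne)

end Components

/-! ### The group `G` and the form `τ₀` -/

theorem pow_card_eq_one {I : Type v} {l : ℕ} (a : KGroup I l) : a ^ l = 1 := by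
  funext i
  refine Multiplicative.toAdd.injective ?_
  rw [Pi.pow_apply, toAdd_pow]
  simp

/-- Raising to the power `(l + 1) / 2` inverts squaring. -/
theorem sq_injective {I : Type v} {l : ℕ} (hodd : Odd l) {a b : KGroup I l}
    (h : a ^ 2 = b ^ 2) : a = b := by
  obtain ⟨m, hm⟩ := hodd
  have key : ∀ c : KGroup I l, (c ^ 2) ^ (m + 1) = c := fun c => by
    rw [← pow_mul, show 2 * (m + 1) = l + 1 by omega, pow_succ, pow_card_eq_one, one_mul]
  rw [← key a, h, key]

/-- Symmetry moves both components into the same slot, exhibiting `C` as the preimage of the radical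
under multiplication. -/
theorem mem_centralSubgroup_iff {I : Type v} [DecidableEq I] {l : ℕ} {k : Type u} [Field k]
    {τ₀ : KGroup I l →* KGroup I l →* kˣ} (hsymm : ∀ a b, τ₀ a b = τ₀ b a)
    {a b : KGroup I l} :
    (a, b) ∈ centralSubgroup τ₀ (K l) (K l) ↔ ∀ j, τ₀ (a * b) (K l j) = 1 := by
  refine forall_congr' fun j => ?_
  rw [map_mul, MonoidHom.mul_apply, hsymm b]

/-- The antidiagonal is the kernel of multiplication and `C` the preimage of the radical;
multiplication is onto, as the pairs `(a, 1)` show. -/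
theorem antidiagonal_eq_centralSubgroup_iff {I : Type v} [DecidableEq I] {l : ℕ} {k : Type u}
    [Field k] {τ₀ : KGroup I l →* KGroup I l →* kˣ} (hsymm : ∀ a b, τ₀ a b = τ₀ b a) :
    antidiagonal (KGroup I l) = centralSubgroup τ₀ (K l) (K l) ↔
      ∀ a, (∀ j, τ₀ a (K l j) = 1) → a = 1 := by
  constructor
  · intro h a ha
    have : (a, 1) ∈ centralSubgroup τ₀ (K l) (K l) := by
      rw [mem_centralSubgroup_iff hsymm]
      simpa using ha
    rw [← h] at this
    exact (inv_eq_one.1 (show a⁻¹ = 1 from (Eq.symm this)))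
  · intro h
    ext ⟨a, b⟩
    rw [mem_centralSubgroup_iff hsymm]
    constructor
    · intro (hab : b = a⁻¹) j
      simp [hab]
    · intro hab
      exact eq_inv_of_mul_eq_one_right (h _ hab)

section Form

variable {I : Type v} [DecidableEq I] {l : ℕ} [NeZero l]

theorem mulSingle_eq_K_pow (i : I) (x : Multiplicative (ZMod l)) :
    (Pi.mulSingle i x : KGroup I l) = K l i ^ (Multiplicative.toAdd x).val := by
  rw [K, ← Pi.mulSingle_pow, ← ofAdd_nsmul, nsmul_one, ZMod.natCast_zmod_val, ofAdd_toAdd]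

variable [Fintype I]

theorem eq_prod_K_pow (a : KGroup I l) :
    a = ∏ i, K l i ^ (Multiplicative.toAdd (a i)).val := by
  conv_lhs => rw [← Finset.univ_prod_mulSingle a]
  exact Finset.prod_congr rfl fun i _ => mulSingle_eq_K_pow i _

theorem closure_range_K : Subgroup.closure (Set.range (K l : I → KGroup I l)) = ⊤ := by
  refine top_unique fun a _ => ?_
  rw [eq_prod_K_pow a]
  exact Subgroup.prod_mem _ fun i _ => Subgroup.pow_mem _ (Subgroup.subset_closure (Set.mem_range_self i)) _

theorem hom_ext_K {H : Type*} [Group H] {f g : KGroup I l →* H}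
    (h : ∀ i, f (K l i) = g (K l i)) : f = g :=
  MonoidHom.eq_of_eqOn_dense closure_range_K (by rintro _ ⟨i, rfl⟩; exact h i)

theorem pairing_symm {H : Type*} [CommGroup H] {τ : KGroup I l →* KGroup I l →* H}
    (h : ∀ i j, τ (K l i) (K l j) = τ (K l j) (K l i)) (a b : KGroup I l) :
    τ a b = τ b a := by
  have : τ = τ.flip := hom_ext_K fun i => hom_ext_K fun j => h i j
  exact DFunLike.congr_fun (DFunLike.congr_fun this a) b

/-- Every element of the antidiagonal is a product of elements `(K_i, K_i⁻¹)^{±1}`. -/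
theorem antidiagonal_le {N : Subgroup (KGroup I l × KGroup I l)}
    (h : ∀ i, (K l i, (K l i)⁻¹) ∈ N) : antidiagonal (KGroup I l) ≤ N := by
  rintro ⟨a, b⟩ (hab : b = a⁻¹)
  subst hab
  -- The antidiagonal is the image of `a ↦ (a, a⁻¹)`, a homomorphism since the group is commutative,
  -- so generators of `G` suffice.
  let δ : KGroup I l →* KGroup I l × KGroup I l := (MonoidHom.id _).prod invMonoidHom
  have : Subgroup.closure (Set.range (K l : I → KGroup I l)) ≤ N.comap δ := by
    rw [Subgroup.closure_le]
    rintro _ ⟨i, rfl⟩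
    exact h i
  rw [closure_range_K] at this
  exact this (Subgroup.mem_top a)

/-- Because the `K_i` generate `G`, the subgroup `P` is the whole diagonal. -/
theorem pairSubgroup_K_eq : pairSubgroup (K l) (K l) =
    ((MonoidHom.id (KGroup I l)).prod (MonoidHom.id _)).range := by
  rw [MonoidHom.range_eq_map, ← closure_range_K, MonoidHom.map_closure, ← Set.range_comp]
  rfl

variable {k : Type u} [Field k] {A : Matrix I I ℤ} {d : I → ℕ} {q : k}
  {τ₀ : KGroup I l →* KGroup I l →* kˣ}

/-- The matrix of the form `τ₀`, up to sign, with respect to the generators `K_i`. -/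
def formMatrix (A : Matrix I I ℤ) (d : I → ℕ) (l : ℕ) : Matrix I I (ZMod l) :=
  (Matrix.diagonal (fun i => (d i : ℤ)) * A).map (Int.castRingHom (ZMod l))

/-- With `a = ∏ K_i ^ a_i` the value is `q` to the power `-∑ a_i d_i a_ij`; since `q` is primitive
it equals `1` exactly when `l` divides the exponent, and the sign becomes irrelevant. -/
theorem apply_K_eq_one_iff (hq : IsPrimitiveRoot q l)
    (hτ₀ : ∀ i j, (τ₀ (K l i) (K l j) : k) = q ^ (-((d i : ℤ) * A i j)))
    (a : KGroup I l) (j : I) :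
    τ₀ a (K l j) = 1 ↔
      Matrix.vecMul (fun i => Multiplicative.toAdd (a i)) (formMatrix A d l) j = 0 := by
  have hq0 : q ≠ 0 := hq.ne_zero (NeZero.ne l)
  have hsum : ∀ (s : Finset I) (e : I → ℤ), ∏ i ∈ s, q ^ e i = q ^ ∑ i ∈ s, e i := by
    intro s e
    induction s using Finset.induction_on with
    | empty => simp
    | insert i s hi ih => rw [Finset.prod_insert hi, Finset.sum_insert hi, ih, zpow_add₀ hq0]
  have h1 : (τ₀ a (K l j) : k) =
      q ^ (-∑ i, ((Multiplicative.toAdd (a i)).val : ℤ) * ((d i : ℤ) * A i j)) := by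
    conv_lhs => rw [eq_prod_K_pow a]
    rw [map_prod, MonoidHom.finsetProd_apply, Units.coe_prod, ← Finset.sum_neg_distrib, ← hsum]
    refine Finset.prod_congr rfl fun i _ => ?_
    rw [map_pow, MonoidHom.pow_apply, Units.val_pow_eq_pow_val, hτ₀, ← zpow_natCast, ← zpow_mul]
    congr 1
    ring
  rw [← Units.val_eq_one, h1, hq.zpow_eq_one_iff_dvd, dvd_neg, ← ZMod.intCast_zmod_eq_zero_iff_dvd]
  simp [formMatrix, Matrix.vecMul, dotProduct, Matrix.diagonal_mul]

/-- Finiteness of `R` turns injectivity into surjectivity; over a general commutative ring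
injectivity would not make the determinant a unit. -/
theorem isUnit_iff_vecMul_injective {R : Type*} [CommRing R] [Finite R] (M : Matrix I I R) :
    IsUnit M.det ↔ ∀ x, Matrix.vecMul x M = 0 → x = 0 := by
  rw [← Matrix.isUnit_iff_isUnit_det, ← Matrix.vecMul_surjective_iff_isUnit,
    ← Finite.injective_iff_surjective]
  exact injective_iff_map_eq_zero (Matrix.vecMulLinear M)

/-- The radical of `τ₀` is trivial if and only if `l` is prime to `det A`. -/
theorem radical_eq_bot_iff (hq : IsPrimitiveRoot q l)
    (hτ₀ : ∀ i j, (τ₀ (K l i) (K l j) : k) = q ^ (-((d i : ℤ) * A i j)))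
    (hd : ∀ i, Nat.Coprime (d i) l) :
    (∀ a, (∀ j, τ₀ a (K l j) = 1) → a = 1) ↔ IsCoprime (l : ℤ) A.det := by
  have hM : IsUnit (formMatrix A d l).det ↔ IsCoprime (l : ℤ) A.det := by
    have hdu : IsUnit (∏ i, ((d i : ℤ) : ZMod l)) := by
      rw [IsUnit.prod_univ_iff]
      intro i
      exact_mod_cast (ZMod.isUnit_iff_coprime _ _).2 (hd i)
    rw [formMatrix, ← RingHom.mapMatrix_apply, ← RingHom.map_det, Matrix.det_mul,
      Matrix.det_diagonal, map_mul, IsUnit.mul_iff]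
    simp only [eq_intCast, Int.cast_prod, hdu, true_and]
    rw [ZMod.coe_int_isUnit_iff_isCoprime]
  rw [← hM, isUnit_iff_vecMul_injective]
  constructor
  · intro h x hx
    have := h (fun i => Multiplicative.ofAdd (x i)) fun j => by
      rw [apply_K_eq_one_iff hq hτ₀]
      exact congrFun hx j
    funext i
    exact congrArg Multiplicative.toAdd (congrFun this i)
  · intro h a ha
    have := h (fun i => Multiplicative.toAdd (a i)) (funext fun j =>
      (apply_K_eq_one_iff hq hτ₀ a j).1 (ha j))
    funext i
    exact congrArg Multiplicative.ofAdd (congrFun this i)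

/-- A diagonal pair `(a, a)` is in `C` exactly when `a²` is in the radical. A trivial radical then
gives `a² = 1`, and oddness gives `a = 1`. -/
theorem centralSubgroup_inf_pairSubgroup_iff (hsymm : ∀ a b, τ₀ a b = τ₀ b a)
    (hodd : Odd l) :
    centralSubgroup τ₀ (K l) (K l) ⊓ pairSubgroup (K l) (K l) = ⊥ ↔
      ∀ a, (∀ j, τ₀ a (K l j) = 1) → a = 1 := by
  rw [pairSubgroup_K_eq, eq_bot_iff]
  constructor
  · intro h a ha
    have : (a, a) ∈ centralSubgroup τ₀ (K l) (K l) ⊓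
        ((MonoidHom.id (KGroup I l)).prod (MonoidHom.id _)).range := by
      refine ⟨(mem_centralSubgroup_iff hsymm).2 fun j => ?_, ⟨a, rfl⟩⟩
      rw [map_mul, MonoidHom.mul_apply, ha, one_mul]
    exact congrArg Prod.fst (Subgroup.mem_bot.1 (h this))
  · rintro h _ ⟨hx, ⟨a, rfl⟩⟩
    have := h _ ((mem_centralSubgroup_iff hsymm).1 hx)
    have ha : a = 1 := sq_injective hodd (by simpa [sq] using this)
    rw [ha, map_one]
    exact Subgroup.one_mem _

/-- Pairing trivially with the generators is pairing trivially with everything, and symmetry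
identifies the two one-sided radicals. -/
theorem nondegenerate_iff (hsymm : ∀ a b, τ₀ a b = τ₀ b a) :
    Nondegenerate τ₀ ↔ ∀ a, (∀ j, τ₀ a (K l j) = 1) → a = 1 := by
  have hK : ∀ a, (∀ b, τ₀ a b = 1) ↔ ∀ j, τ₀ a (K l j) = 1 := fun a => by
    refine ⟨fun h j => h _, fun h b => ?_⟩
    have : τ₀ a = 1 := hom_ext_K h
    rw [this, MonoidHom.one_apply]
  constructor
  · rintro ⟨h, -⟩ a ha
    exact h a ((hK a).2 ha)
  · intro h
    refine ⟨fun a ha => h a ((hK a).1 ha), fun b hb => h b fun j => ?_⟩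
    rw [hsymm]
    exact hb _

end Form

/-- For `G` of odd exponent, the homomorphism from `G × G` onto the antidiagonal that kills the
diagonal: `(a, b) ↦ (h, h⁻¹)` with `h² = a b⁻¹`. -/
def antidiagonalProj (G : Type w) [CommGroup G] (m : ℕ) : G × G →* antidiagonal G :=
  (((MonoidHom.id G).prod invMonoidHom).codRestrict (antidiagonal G) fun _ => rfl).comp
    ((powMonoidHom m).comp divMonoidHom)

/-- The hypothesis makes `m` an inverse of `2` on exponents, so `(a / a⁻¹) ^ m = a ^ (2 * m) = a`.
-/
theorem antidiagonalProj_coe {G : Type w} [CommGroup G] {m : ℕ} (hm : ∀ a : G, a ^ (2 * m) = a)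
    (t : antidiagonal G) : antidiagonalProj G m t = t := by
  obtain ⟨⟨a, b⟩, hab⟩ := t
  obtain rfl : b = a⁻¹ := hab
  have : (a / a⁻¹) ^ m = a := by rw [div_inv_eq_mul, ← sq, ← pow_mul, hm]
  exact Subtype.ext (Prod.ext this (congrArg (·⁻¹) this))

theorem antidiagonalProj_diag {G : Type w} [CommGroup G] {m : ℕ} (a : G) :
    antidiagonalProj G m (a, a) = 1 := by
  have : divMonoidHom (a, a) = 1 := div_self' a
  rw [antidiagonalProj, MonoidHom.comp_apply, MonoidHom.comp_apply, this, map_one, map_one]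

/-! ### Splitting off central grouplikes -/

namespace Double

section Split

variable {k : Type u} [Field k] {I : Type v} {F G : Type w} [CommGroup F] [CommGroup G]
  {τ₀ : F →* G →* kˣ} {f : I → F} {g : I → G}
  (R : PreNichols (leftChar τ₀ g) f) (S : PreNichols (rightChar τ₀ f) g)

/-- The scalar in the commutation rules with `v_i` and `w_i` is precisely the one required to be `1`
in the definition of `C`. -/
theorem commute_grp {x : F × G} (hx : x ∈ centralSubgroup τ₀ f g) (a : Double R S) :
    Commute (grp R S x) a := by
  induction a using induction with
  | hk r => exact (Algebra.commutes r _).symm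
  | hv i => rw [commute_iff_eq, grp_v, hx i, Units.val_one, one_smul]
  | hw i => exact Commute.symm (by rw [commute_iff_eq, w_grp, hx i, Units.val_one, one_smul])
  | hg y => rw [commute_iff_eq, ← map_mul, ← map_mul, mul_comm]
  | hadd a b ha hb => exact ha.add_right hb
  | hmul a b ha hb => exact ha.mul_right hb

/-! ### Hopf algebra maps from `𝒟` to group algebras. -/

variable {H : Type*} [CommGroup H] (p : F × G →* H) (hp : ∀ i, p (f i, g i) = 1)

/-- The algebra map `𝒟 → kH` which kills all `v_i` and `w_i` and extends a homomorphism
`F × G → H` that is trivial on all `f_i g_i`. -/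
def groupHom : Double R S →ₐ[k] MonoidAlgebra k H :=
  lift (fun _ => 0) (fun _ => 0) ((MonoidAlgebra.of k H).comp p) (by simp) (by simp)
    -- With `v_i` and `w_i` sent to zero, the cross relation leaves only `p (f i, g i) - 1 = 0`;
    -- this is where `hp` is needed.
    (by intro i; rw [MonoidHom.comp_apply, hp, map_one]; simp) (by simp)
    -- Sending all generators to zero is the counit followed by the unit map, and the relations lie
    -- in the kernel of the counit.
    (fun r hr => by
      have : FreeAlgebra.lift k (fun _ : I => (0 : MonoidAlgebra k H)) =
          (Algebra.ofId k _).comp (brCounit k I) := by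
        ext i; simp [brCounit]
      rw [this, AlgHom.comp_apply, R.counit_eq_zero r hr, map_zero])
    (fun r hr => by
      have : FreeAlgebra.lift k (fun _ : I => (0 : MonoidAlgebra k H)) =
          (Algebra.ofId k _).comp (brCounit k I) := by
        ext i; simp [brCounit]
      rw [this, AlgHom.comp_apply, S.counit_eq_zero r hr, map_zero])

@[simp] theorem groupHom_v (i : I) : groupHom R S p hp (v R S i) = 0 := lift_apply_v i

@[simp] theorem groupHom_w (i : I) : groupHom R S p hp (w R S i) = 0 := lift_apply_w i

@[simp] theorem groupHom_grp (x : F × G) :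
    groupHom R S p hp (grp R S x) = MonoidAlgebra.of k H (p x) := lift_apply_grp x

/-- `groupHom` as a map of bialgebras. -/
def groupBialgHom : Double R S →ₐc[k] MonoidAlgebra k H :=
  .ofAlgHom (groupHom R S p hp)
    (by
      apply algHom_ext
      · intro i
        rw [AlgHom.comp_apply, groupHom_v, map_zero]
        exact (counitHom_v R S i).symm
      · intro i
        rw [AlgHom.comp_apply, groupHom_w, map_zero]
        exact (counitHom_w R S i).symm
      · intro x
        rw [AlgHom.comp_apply, groupHom_grp]
        refine Eq.trans ?_ (counitHom_grp R S x).symm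
        simp)
    (by
      apply algHom_ext
      · intro i
        rw [AlgHom.comp_apply, AlgHom.comp_apply, groupHom_v, map_zero]
        refine (congrArg _ (comulHom_v R S i)).trans ?_
        simp
      · intro i
        rw [AlgHom.comp_apply, AlgHom.comp_apply, groupHom_w, map_zero]
        refine (congrArg _ (comulHom_w R S i)).trans ?_
        simp
      · intro x
        rw [AlgHom.comp_apply, AlgHom.comp_apply, groupHom_grp]
        refine (congrArg _ (comulHom_grp R S x)).trans ?_
        simp)

/-- This is the Hopf splitting: a retraction of groups onto `C` that kills all `(f i, g i)`
linearises to a retraction of `𝒟` onto `kC`. -/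
theorem groupBialgHom_groupIncl {C : Subgroup (F × G)} (p : F × G →* C)
    (hp : ∀ i, p (f i, g i) = 1) (hpC : ∀ c : C, p c = c) (x : MonoidAlgebra k C) :
    groupBialgHom R S p hp (groupIncl R S C x) = x := by
  have : (groupHom R S p hp).comp (MonoidAlgebra.lift k (Double R S) C
      ((grp R S).comp C.subtype)) = AlgHom.id k _ := by
    ext c
    simp [hpC]
  exact DFunLike.congr_fun this x

/-! ### The decomposition of `𝒟` over a central group of grouplikes. -/

variable {C : Subgroup (F × G)} (q : F × G →* C) (hq : ∀ i, q (f i, g i) = 1)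

/-- The algebra map `𝒟 → kC ⊗ 𝒟 / (c - 1 ∣ c ∈ C)` obtained from a map `σ : 𝒟 → 𝒟 ⊗ 𝒟`, usually
the coproduct or its opposite, by projecting to both factors. -/
def splitHom (σ : Double R S →ₐ[k] Double R S ⊗[k] Double R S) :
    Double R S →ₐ[k] MonoidAlgebra k C ⊗[k] (Double R S ⧸ groupIdeal R S C) :=
  (Algebra.TensorProduct.map (groupHom R S q hq)
    (Ideal.Quotient.mkₐ k (groupIdeal R S C))).comp σ

section Bijective

variable {σ : Double R S →ₐ[k] Double R S ⊗[k] Double R S} {ev ew : I → F × G}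

/-- The hypothesis on `σ` covers both the coproduct (`y = 1`, `ev i = (f i, 1)`) and its opposite
(`y` the grouplike of `(f i, 1)`, `ev i = 1`). The term with `v_i` on the left dies since `groupHom`
kills it. -/
theorem splitHom_v {i : I} {y : Double R S}
    (h : σ (v R S i) = v R S i ⊗ₜ y + grp R S (ev i) ⊗ₜ v R S i) :
    splitHom R S q hq σ (v R S i) = MonoidAlgebra.of k C (q (ev i)) ⊗ₜ
      Ideal.Quotient.mkₐ k (groupIdeal R S C) (v R S i) := by
  rw [splitHom, AlgHom.comp_apply, h]
  simp only [map_add, Algebra.TensorProduct.map_tmul, groupHom_v, groupHom_grp,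
    TensorProduct.zero_tmul, zero_add]

theorem splitHom_w {i : I} {y : Double R S}
    (h : σ (w R S i) = w R S i ⊗ₜ y + grp R S (ew i) ⊗ₜ w R S i) :
    splitHom R S q hq σ (w R S i) = MonoidAlgebra.of k C (q (ew i)) ⊗ₜ
      Ideal.Quotient.mkₐ k (groupIdeal R S C) (w R S i) := by
  rw [splitHom, AlgHom.comp_apply, h]
  simp only [map_add, Algebra.TensorProduct.map_tmul, groupHom_w, groupHom_grp,
    TensorProduct.zero_tmul, zero_add]

theorem splitHom_grp {x : F × G} (h : σ (grp R S x) = grp R S x ⊗ₜ grp R S x) :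
    splitHom R S q hq σ (grp R S x) = MonoidAlgebra.of k C (q x) ⊗ₜ
      Ideal.Quotient.mkₐ k (groupIdeal R S C) (grp R S x) := by
  rw [splitHom, AlgHom.comp_apply, h, Algebra.TensorProduct.map_tmul, groupHom_grp]

theorem commute_groupIncl (hC : C ≤ centralSubgroup τ₀ f g) (x : MonoidAlgebra k C)
    (a : Double R S) : Commute (groupIncl R S C x) a := by
  induction x using MonoidAlgebra.induction_linear with
  | zero => rw [map_zero]; exact Commute.zero_left a
  | add x y hx hy => rw [map_add]; exact hx.add_left hy
  | single c r =>
    have : groupIncl R S C (MonoidAlgebra.single c r) = r • grp R S c :=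
      MonoidAlgebra.lift_single _ _ _
    rw [this]
    exact (commute_grp R S (hC c.2) a).smul_left r

theorem groupIncl_of (c : C) : groupIncl R S C (MonoidAlgebra.of k C c) = grp R S c :=
  MonoidAlgebra.lift_of _ _

/-- The map `𝒟 → kC → 𝒟` inverse to `groupHom` under convolution. -/
def groupHomInv : Double R S →ₐ[k] Double R S :=
  (groupIncl R S C : MonoidAlgebra k C →ₐ[k] Double R S).comp
    (groupHom R S q⁻¹ fun i => by rw [MonoidHom.inv_apply, hq, inv_one])

theorem groupHomInv_v (i : I) : groupHomInv R S q hq (v R S i) = 0 := by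
  rw [groupHomInv, AlgHom.comp_apply, groupHom_v, map_zero]

theorem groupHomInv_w (i : I) : groupHomInv R S q hq (w R S i) = 0 := by
  rw [groupHomInv, AlgHom.comp_apply, groupHom_w, map_zero]

theorem groupHomInv_grp (x : F × G) :
    groupHomInv R S q hq (grp R S x) = grp R S (q x : F × G)⁻¹ := by
  rw [groupHomInv, AlgHom.comp_apply, groupHom_grp]
  exact groupIncl_of R S _

/-- Centrality of `kC` makes the convolution of `groupHomInv` with the identity an algebra map. -/
theorem commute_groupHomInv (hC : C ≤ centralSubgroup τ₀ f g) (a b : Double R S) :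
    Commute (groupHomInv R S q hq a) (AlgHom.id k (Double R S) b) :=
  commute_groupIncl R S hC _ _

/-- The retraction of `𝒟` onto its coinvariants: `a ↦ π(a₁)⁻¹ a₂` if `σ` is the coproduct. -/
def coinvHom (hC : C ≤ centralSubgroup τ₀ f g)
    (σ : Double R S →ₐ[k] Double R S ⊗[k] Double R S) : Double R S →ₐ[k] Double R S :=
  (Algebra.TensorProduct.lift (groupHomInv R S q hq) (AlgHom.id k _)
    (commute_groupHomInv R S q hq hC)).comp σ

theorem coinvHom_v (hC : C ≤ centralSubgroup τ₀ f g) {i : I} {y : Double R S}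
    (h : σ (v R S i) = v R S i ⊗ₜ y + grp R S (ev i) ⊗ₜ v R S i) :
    coinvHom R S q hq hC σ (v R S i) = grp R S (q (ev i))⁻¹ * v R S i := by
  rw [coinvHom, AlgHom.comp_apply, h]
  rw [map_add, Algebra.TensorProduct.lift_tmul, Algebra.TensorProduct.lift_tmul,
    groupHomInv_v, zero_mul, zero_add, groupHomInv_grp, AlgHom.id_apply]

theorem coinvHom_w (hC : C ≤ centralSubgroup τ₀ f g) {i : I} {y : Double R S}
    (h : σ (w R S i) = w R S i ⊗ₜ y + grp R S (ew i) ⊗ₜ w R S i) :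
    coinvHom R S q hq hC σ (w R S i) = grp R S (q (ew i))⁻¹ * w R S i := by
  rw [coinvHom, AlgHom.comp_apply, h]
  rw [map_add, Algebra.TensorProduct.lift_tmul, Algebra.TensorProduct.lift_tmul,
    groupHomInv_w, zero_mul, zero_add, groupHomInv_grp, AlgHom.id_apply]

theorem coinvHom_grp (hC : C ≤ centralSubgroup τ₀ f g) {x : F × G}
    (h : σ (grp R S x) = grp R S x ⊗ₜ grp R S x) :
    coinvHom R S q hq hC σ (grp R S x) = grp R S (q x)⁻¹ * grp R S x := by
  rw [coinvHom, AlgHom.comp_apply, h, Algebra.TensorProduct.lift_tmul, groupHomInv_grp,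
    AlgHom.id_apply]

/-- The inverse is `c ⊗ ā ↦ c κ(a)` with `κ` the map `coinvHom`. Both composites with `splitHom` are
algebra maps, so the factors `q(e)` and `q(e)⁻¹` need only cancel on generators. -/
theorem splitHom_bijective (hC : C ≤ centralSubgroup τ₀ f g) (hqC : ∀ c : C, q c = c)
    (hv : ∀ i, ∃ y, σ (v R S i) = v R S i ⊗ₜ y + grp R S (ev i) ⊗ₜ v R S i)
    (hw : ∀ i, ∃ y, σ (w R S i) = w R S i ⊗ₜ y + grp R S (ew i) ⊗ₜ w R S i)
    (hg : ∀ x, σ (grp R S x) = grp R S x ⊗ₜ grp R S x) :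
    Function.Bijective (splitHom R S q hq σ) := by
  choose yv hv using hv
  choose yw hw using hw
  -- `κ` descends to the quotient because `κ(t) = q(t)⁻¹ t = 1` for `t ∈ C`.
  let s : (Double R S ⧸ groupIdeal R S C) →ₐ[k] Double R S :=
    Ideal.Quotient.liftₐ (groupIdeal R S C) (coinvHom R S q hq hC σ) fun a ha =>
      groupIdeal_induction _ (fun t ht => by
        rw [coinvHom_grp R S q hq hC (hg t), hqC ⟨t, ht⟩, ← map_mul, inv_mul_cancel, map_one]) ha
  have hs : ∀ a, s (Ideal.Quotient.mkₐ k (groupIdeal R S C) a) = coinvHom R S q hq hC σ a :=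
    fun a => rfl
  let ψ : MonoidAlgebra k C ⊗[k] (Double R S ⧸ groupIdeal R S C) →ₐ[k] Double R S :=
    Algebra.TensorProduct.lift (groupIncl R S C : MonoidAlgebra k C →ₐ[k] Double R S) s
      fun _ _ => commute_groupIncl R S hC _ _
  have hψ : ∀ c a, ψ (MonoidAlgebra.of k C c ⊗ₜ Ideal.Quotient.mkₐ k (groupIdeal R S C) a) =
      grp R S c * coinvHom R S q hq hC σ a := fun c a => by
    rw [← hs, ← groupIncl_of]
    exact Algebra.TensorProduct.lift_tmul ..
  have h1 : ψ.comp (splitHom R S q hq σ) = AlgHom.id k _ := by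
    apply algHom_ext
    · intro i
      rw [AlgHom.comp_apply, splitHom_v R S q hq (hv i), hψ, coinvHom_v R S q hq hC (hv i),
        ← mul_assoc, ← map_mul, mul_inv_cancel, map_one, one_mul, AlgHom.id_apply]
    · intro i
      rw [AlgHom.comp_apply, splitHom_w R S q hq (hw i), hψ, coinvHom_w R S q hq hC (hw i),
        ← mul_assoc, ← map_mul, mul_inv_cancel, map_one, one_mul, AlgHom.id_apply]
    · intro x
      rw [AlgHom.comp_apply, splitHom_grp R S q hq (hg x), hψ, coinvHom_grp R S q hq hC (hg x),
        ← mul_assoc, ← map_mul, mul_inv_cancel, map_one, one_mul, AlgHom.id_apply]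
  have hC1 : ∀ c : C, splitHom R S q hq σ (grp R S c) = MonoidAlgebra.of k C c ⊗ₜ 1 := fun c => by
    rw [splitHom_grp R S q hq (hg c), hqC, mk_grp R S c.2]
  have hC2 : ∀ c : C, splitHom R S q hq σ (grp R S (c : F × G)⁻¹) =
      MonoidAlgebra.of k C c⁻¹ ⊗ₜ 1 := fun c => hC1 c⁻¹
  have hcancel : ∀ (c : C) (a : Double R S ⧸ groupIdeal R S C),
      (MonoidAlgebra.of k C c⁻¹ ⊗ₜ[k] (1 : Double R S ⧸ groupIdeal R S C)) *
        (MonoidAlgebra.of k C c ⊗ₜ a) = 1 ⊗ₜ a := fun c a => by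
    rw [Algebra.TensorProduct.tmul_mul_tmul, ← map_mul, inv_mul_cancel, map_one, one_mul]
  have h2 : (splitHom R S q hq σ).comp ψ = AlgHom.id k _ := by
    -- The two tensor factors are tested separately: on `kC` the composite fixes each `c ⊗ 1`, and
    -- on the quotient `hcancel` removes the group factor.
    apply Algebra.TensorProduct.ext
    · ext c
      have := hψ c 1
      rw [map_one, map_one, mul_one] at this
      refine (congrArg (splitHom R S q hq σ) this).trans ?_
      exact hC1 c
    · apply Ideal.Quotient.algHom_ext
      have key : ∀ a, ψ (1 ⊗ₜ Ideal.Quotient.mkₐ k (groupIdeal R S C) a) =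
          coinvHom R S q hq hC σ a := fun a => by
        have := hψ 1 a
        rwa [map_one, OneMemClass.coe_one, map_one, one_mul] at this
      apply algHom_ext
      · intro i
        refine (congrArg (splitHom R S q hq σ) (key _)).trans ?_
        rw [coinvHom_v R S q hq hC (hv i), map_mul, hC2, splitHom_v R S q hq (hv i), hcancel]
        rfl
      · intro i
        refine (congrArg (splitHom R S q hq σ) (key _)).trans ?_
        rw [coinvHom_w R S q hq hC (hw i), map_mul, hC2, splitHom_w R S q hq (hw i), hcancel]
        rfl
      · intro x
        refine (congrArg (splitHom R S q hq σ) (key _)).trans ?_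
        rw [coinvHom_grp R S q hq hC (hg x), map_mul, hC2, splitHom_grp R S q hq (hg x), hcancel]
        rfl
  exact Function.bijective_iff_has_inverse.2
    ⟨ψ, DFunLike.congr_fun h1, DFunLike.congr_fun h2⟩

end Bijective

/-! ### Compatibility of the decomposition with the comodule structures. -/

theorem comul_mk (a : Double R S) :
    Coalgebra.comul (R := k) (Ideal.Quotient.mkₐ k (groupIdeal R S C) a) =
      Algebra.TensorProduct.map (Ideal.Quotient.mkₐ k (groupIdeal R S C))
        (Ideal.Quotient.mkₐ k (groupIdeal R S C)) (comulHom R S a) := rfl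

/-- The splitting as right comodule algebras. -/
theorem exists_rightEquiv (hC : C ≤ centralSubgroup τ₀ f g) (hqC : ∀ c : C, q c = c)
    (hq : ∀ i, q (f i, g i) = 1) :
    ∃ φ : Double R S ≃ₐ[k] MonoidAlgebra k C ⊗[k] (Double R S ⧸ groupIdeal R S C),
      ∀ a, freeCoactRight k (MonoidAlgebra k C) _ (φ a) =
        φ.toLinearMap.rTensor _ (coactRight R S C a) := by
  have hv : ∀ i, ∃ y, comulHom R S (v R S i) =
      v R S i ⊗ₜ y + grp R S (f i, 1) ⊗ₜ v R S i := fun i => ⟨1, comulHom_v R S i⟩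
  have hw : ∀ i, ∃ y, comulHom R S (w R S i) =
      w R S i ⊗ₜ y + grp R S (1, g i) ⊗ₜ w R S i := fun i => ⟨1, comulHom_w R S i⟩
  refine ⟨AlgEquiv.ofBijective (splitHom R S q hq (comulHom R S))
    (splitHom_bijective R S q hq (ev := fun i => (f i, 1)) (ew := fun i => (1, g i)) hC hqC
      hv hw (comulHom_grp R S)), ?_⟩
  -- The coaction on `kC ⊗ 𝒟_c`, repackaged as an algebra map so that colinearity can be tested on
  -- the generators of `𝒟`.
  let ρ := (Algebra.TensorProduct.assoc k k k (MonoidAlgebra k C)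
    (Double R S ⧸ groupIdeal R S C) (Double R S ⧸ groupIdeal R S C)).symm.toAlgHom.comp
      (Algebra.TensorProduct.map (AlgHom.id k (MonoidAlgebra k C))
        (Bialgebra.comulAlgHom k (Double R S ⧸ groupIdeal R S C)))
  have key : ρ.comp (splitHom R S q hq (comulHom R S)) =
      ((Algebra.TensorProduct.map (splitHom R S q hq (comulHom R S)) (AlgHom.id k _)).comp
        (Algebra.TensorProduct.map (AlgHom.id k _)
          (Ideal.Quotient.mkₐ k (groupIdeal R S C)))).comp (comulHom R S) := by
    refine algHom_ext (R := R) (S := S) (A := (MonoidAlgebra k C ⊗[k]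
      (Double R S ⧸ groupIdeal R S C)) ⊗[k] (Double R S ⧸ groupIdeal R S C)) ?_ ?_ ?_
    · intro i
      obtain ⟨y, hy⟩ := hv i
      simp only [AlgHom.comp_apply]
      rw [splitHom_v R S q hq (ev := fun i => (f i, 1)) hy]
      simp only [ρ, AlgHom.comp_apply, Algebra.TensorProduct.map_tmul,
        Bialgebra.comulAlgHom_apply, comul_mk, comulHom_v, map_add, AlgHom.id_apply, map_one,
        TensorProduct.tmul_add]
      rw [splitHom_v R S q hq (ev := fun i => (f i, 1)) hy,
        splitHom_grp R S q hq (comulHom_grp R S _)]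
      rfl
    · intro i
      obtain ⟨y, hy⟩ := hw i
      simp only [AlgHom.comp_apply]
      rw [splitHom_w R S q hq (ew := fun i => (1, g i)) hy]
      simp only [ρ, AlgHom.comp_apply, Algebra.TensorProduct.map_tmul,
        Bialgebra.comulAlgHom_apply, comul_mk, comulHom_w, map_add, AlgHom.id_apply, map_one,
        TensorProduct.tmul_add]
      rw [splitHom_w R S q hq (ew := fun i => (1, g i)) hy,
        splitHom_grp R S q hq (comulHom_grp R S _)]
      rfl
    · intro x
      simp only [AlgHom.comp_apply]
      rw [splitHom_grp R S q hq (comulHom_grp R S _)]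
      simp only [ρ, AlgHom.comp_apply, Algebra.TensorProduct.map_tmul,
        Bialgebra.comulAlgHom_apply, comul_mk, comulHom_grp, AlgHom.id_apply]
      rw [splitHom_grp R S q hq (comulHom_grp R S _)]
      rfl
  exact fun a => DFunLike.congr_fun key a

/-- The splitting as left comodule algebras. -/
theorem exists_leftEquiv (hC : C ≤ centralSubgroup τ₀ f g) (hqC : ∀ c : C, q c = c)
    (hq : ∀ i, q (f i, g i) = 1) :
    ∃ φ : Double R S ≃ₐ[k] MonoidAlgebra k C ⊗[k] (Double R S ⧸ groupIdeal R S C),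
      ∀ a, freeCoactLeft k (MonoidAlgebra k C) _ (φ a) =
        φ.toLinearMap.lTensor _ (coactLeft R S C a) := by
  -- With the opposite coproduct the splitting becomes `a ↦ π(a₂) ⊗ ā₁`, which respects the left
  -- coaction.
  let σ : Double R S →ₐ[k] Double R S ⊗[k] Double R S :=
    (Algebra.TensorProduct.comm k (Double R S) (Double R S)).toAlgHom.comp (comulHom R S)
  -- Writing `1` as the grouplike of `1` fits the general shape with trivial weight, so `v_i ↦ 1 ⊗
  -- v̄_i`.
  have hv : ∀ i, σ (v R S i) = v R S i ⊗ₜ grp R S (f i, 1) + grp R S 1 ⊗ₜ v R S i := fun i => by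
    refine (congrArg (Algebra.TensorProduct.comm k _ _) (comulHom_v R S i)).trans ?_
    rw [map_add, Algebra.TensorProduct.comm_tmul, Algebra.TensorProduct.comm_tmul, add_comm,
      map_one]
  have hw : ∀ i, σ (w R S i) = w R S i ⊗ₜ grp R S (1, g i) + grp R S 1 ⊗ₜ w R S i := fun i => by
    refine (congrArg (Algebra.TensorProduct.comm k _ _) (comulHom_w R S i)).trans ?_
    rw [map_add, Algebra.TensorProduct.comm_tmul, Algebra.TensorProduct.comm_tmul, add_comm,
      map_one]
  have hg : ∀ x, σ (grp R S x) = grp R S x ⊗ₜ grp R S x := fun x =>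
    congrArg (Algebra.TensorProduct.comm k _ _) (comulHom_grp R S x)
  refine ⟨AlgEquiv.ofBijective (splitHom R S q hq σ)
    (splitHom_bijective R S q hq (ev := fun _ => 1) (ew := fun _ => 1) hC hqC
      (fun i => ⟨_, hv i⟩) (fun i => ⟨_, hw i⟩) hg), ?_⟩
  let ρ := (Algebra.TensorProduct.leftComm k (MonoidAlgebra k C)
    (Double R S ⧸ groupIdeal R S C) (Double R S ⧸ groupIdeal R S C)).toAlgHom.comp
      (Algebra.TensorProduct.map (AlgHom.id k (MonoidAlgebra k C))
        (Bialgebra.comulAlgHom k (Double R S ⧸ groupIdeal R S C)))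
  have key : ρ.comp (splitHom R S q hq σ) =
      ((Algebra.TensorProduct.map (AlgHom.id k _) (splitHom R S q hq σ)).comp
        (Algebra.TensorProduct.map (Ideal.Quotient.mkₐ k (groupIdeal R S C))
          (AlgHom.id k _))).comp (comulHom R S) := by
    apply algHom_ext
    · intro i
      simp only [AlgHom.comp_apply]
      rw [splitHom_v R S q hq (ev := fun _ => 1) (hv i)]
      simp only [ρ, AlgHom.comp_apply, Algebra.TensorProduct.map_tmul,
        Bialgebra.comulAlgHom_apply, comul_mk, comulHom_v, map_add, AlgHom.id_apply, map_one,
        TensorProduct.tmul_add]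
      rw [splitHom_v R S q hq (ev := fun _ => 1) (hv i), map_one, map_one]
      rfl
    · intro i
      simp only [AlgHom.comp_apply]
      rw [splitHom_w R S q hq (ew := fun _ => 1) (hw i)]
      simp only [ρ, AlgHom.comp_apply, Algebra.TensorProduct.map_tmul,
        Bialgebra.comulAlgHom_apply, comul_mk, comulHom_w, map_add, AlgHom.id_apply, map_one,
        TensorProduct.tmul_add]
      rw [splitHom_w R S q hq (ew := fun _ => 1) (hw i), map_one, map_one]
      rfl
    · intro x
      simp only [AlgHom.comp_apply]
      rw [splitHom_grp R S q hq (hg _)]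
      simp only [ρ, AlgHom.comp_apply, Algebra.TensorProduct.map_tmul,
        Bialgebra.comulAlgHom_apply, comul_mk, comulHom_grp, AlgHom.id_apply]
      rw [splitHom_grp R S q hq (hg _)]
      rfl
  exact fun a => DFunLike.congr_fun key a

end Split

end Double

/-- The ideals of `𝒟` generated by `(K_i, 1) - (1, K_i)` and by `t - 1`, `t` antidiagonal. -/
theorem flipIdeal_eq {k : Type u} [Field k] {I : Type v} {G : Type w} [CommGroup G]
    {τ₀ : G →* G →* kˣ} {f : I → G} (hf : ∀ N : Subgroup (G × G),
      (∀ i, (f i, (f i)⁻¹) ∈ N) → antidiagonal G ≤ N)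
    (R : PreNichols (leftChar τ₀ f) f) (S : PreNichols (rightChar τ₀ f) f) :
    flipIdeal R S = Double.groupIdeal R S (antidiagonal G) := by
  -- The two kinds of generators differ by an invertible grouplike factor.
  have hfac : ∀ a : G, Double.grp R S (a, 1) - Double.grp R S (1, a) =
      Double.grp R S (1, a) * (Double.grp R S (a, a⁻¹) - 1) := fun a => by
    rw [mul_sub, mul_one, ← map_mul]; simp
  have hfac' : ∀ a : G, Double.grp R S (a, a⁻¹) - 1 =
      Double.grp R S (1, a⁻¹) * (Double.grp R S (a, 1) - Double.grp R S (1, a)) := fun a => by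
    rw [mul_sub, ← map_mul, ← map_mul]; simp [← Prod.one_eq_mk]
  unfold flipIdeal Double.groupIdeal
  congr 1
  set J := TwoSidedIdeal.span
    (Set.range fun i => Double.grp R S (f i, 1) - Double.grp R S (1, f i)) with hJ
  apply le_antisymm
  · rw [TwoSidedIdeal.span_le]
    rintro _ ⟨i, rfl⟩
    simp only [hfac]
    exact TwoSidedIdeal.mul_mem_left _ _ _ (TwoSidedIdeal.subset_span ⟨_, rfl, rfl⟩)
  -- The elements whose grouplike becomes `1` modulo `J` form a kernel, hence a subgroup, so by `hf`
  -- the pairs `(f i, (f i)⁻¹)` suffice.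
  · let N : Subgroup (G × G) := (J.ringCon.mk'.toMonoidHom.comp (Double.grp R S)).ker
    have hN : ∀ x, x ∈ N ↔ Double.grp R S x - 1 ∈ J := fun x => by
      rw [← TwoSidedIdeal.rel_iff]
      exact J.ringCon.eq
    rw [TwoSidedIdeal.span_le]
    rintro _ ⟨t, ht, rfl⟩
    refine (hN t).1 (hf N (fun i => (hN _).2 ?_) ht)
    rw [hfac']
    exact TwoSidedIdeal.mul_mem_left _ _ _ (TwoSidedIdeal.subset_span ⟨i, rfl⟩)

end GQD

end

/-! ### The equivalences and the splitting, assembled. -/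

theorem corollary4p3 {k : Type*} [Field k] {I : Type*} [Fintype I] [DecidableEq I]
    (A : Matrix I I ℤ) (hA : GQD.IsFiniteType A)
    (d : I → ℕ) (hd : GQD.IsStandardSymmetrizer A d)
    (l : ℕ) (hl : 1 < l) (hodd : Odd l)
    (hG₂ : ∀ c : (GQD.dynkinGraph A).ConnectedComponent,
      GQD.HasType A c CartanMatrix.G₂ → ¬ 3 ∣ l)
    (q : k) (hq : IsPrimitiveRoot q l)
    (τ₀ : GQD.KGroup I l →* GQD.KGroup I l →* kˣ)
    (hτ₀ : ∀ i j, (τ₀ (GQD.K l i) (GQD.K l j) : k) = q ^ (-((d i : ℤ) * A i j)))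
    (R : GQD.PreNichols (GQD.leftChar τ₀ (GQD.K l)) (GQD.K l))
    (S : GQD.PreNichols (GQD.rightChar τ₀ (GQD.K l)) (GQD.K l))
    (T C P : Subgroup (GQD.KGroup I l × GQD.KGroup I l))
    (hT : T = GQD.antidiagonal (GQD.KGroup I l))
    (hC : C = GQD.centralSubgroup τ₀ (GQD.K l) (GQD.K l))
    (hP : P = GQD.pairSubgroup (GQD.K l) (GQD.K l)) :
    -- the equivalence of (i), (ii), (iii), (iv) and the explicit form of (iv)
    List.TFAE [
      T = C,
      C ⊓ P = ⊥,
      GQD.Nondegenerate τ₀,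
      IsCoprime (l : ℤ) A.det,
      ∀ c : (GQD.dynkinGraph A).ConnectedComponent,
        (∀ n : ℕ, GQD.HasType A c (CartanMatrix.A n) → Nat.Coprime (n + 1) l) ∧
        (3 ∣ l → ¬ GQD.HasType A c CartanMatrix.E₆)] ∧
    (T = C →
      -- the ideals defining the quotients `𝒟_t` and `𝒟_c` of `𝒟` are equal
      GQD.flipIdeal R S = GQD.Double.groupIdeal R S C ∧
      -- `kC → 𝒟` splits as a Hopf algebra map
      (∃ π : GQD.Double R S →ₐc[k] MonoidAlgebra k C,
        ∀ x, π (GQD.Double.groupIncl R S C x) = x) ∧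
      -- `𝒟 ≅ kC ⊗ 𝒟_c` as right, and as left, `𝒟_c`-comodule algebras
      (∃ φ : GQD.Double R S ≃ₐ[k]
          MonoidAlgebra k C ⊗[k] (GQD.Double R S ⧸ GQD.Double.groupIdeal R S C),
        ∀ a, GQD.freeCoactRight k (MonoidAlgebra k C) _ (φ a) =
          φ.toLinearMap.rTensor _ (GQD.Double.coactRight R S C a)) ∧
      (∃ φ : GQD.Double R S ≃ₐ[k]
          MonoidAlgebra k C ⊗[k] (GQD.Double R S ⧸ GQD.Double.groupIdeal R S C),
        ∀ a, GQD.freeCoactLeft k (MonoidAlgebra k C) _ (φ a) =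
          φ.toLinearMap.lTensor _ (GQD.Double.coactLeft R S C a))) := by
  subst hT hC hP
  have : NeZero l := ⟨by omega⟩
  have hsymm : ∀ a b, τ₀ a b = τ₀ b a := GQD.pairing_symm fun i j => Units.ext <| by
    rw [hτ₀, hτ₀, hd.symm]
  have hTC := GQD.antidiagonal_eq_centralSubgroup_iff hsymm
  constructor
  · have h4 := GQD.radical_eq_bot_iff hq hτ₀ (hd.coprime hA hodd hG₂)
    tfae_have 1 ↔ 4 := hTC.trans h4
    tfae_have 2 ↔ 4 := (GQD.centralSubgroup_inf_pairSubgroup_iff hsymm hodd).trans h4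
    tfae_have 3 ↔ 4 := (GQD.nondegenerate_iff hsymm).trans h4
    tfae_have 4 ↔ 5 := GQD.coprime_det_iff hA hodd
    tfae_finish
  · intro h
    -- Once `C` is replaced by the antidiagonal, the projection onto the latter applies, and `h.le`
    -- supplies centrality.
    rw [← h]
    obtain ⟨m, hm⟩ := hodd
    -- For `l = 2m + 1` the exponent `m + 1` is the inverse of `2` modulo `l`.
    let p := GQD.antidiagonalProj (GQD.KGroup I l) (m + 1)
    have hp : ∀ i, p (GQD.K l i, GQD.K l i) = 1 := fun i => GQD.antidiagonalProj_diag _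
    have hpT : ∀ t : GQD.antidiagonal (GQD.KGroup I l), p t = t :=
      GQD.antidiagonalProj_coe fun a => by
        rw [show 2 * (m + 1) = l + 1 by omega, pow_succ, GQD.pow_card_eq_one, one_mul]
    exact ⟨GQD.flipIdeal_eq (fun N => GQD.antidiagonal_le) R S,
      ⟨GQD.Double.groupBialgHom R S p hp, GQD.Double.groupBialgHom_groupIncl R S p hp hpT⟩,
      GQD.Double.exists_rightEquiv R S p h.le hpT hp,
      GQD.Double.exists_leftEquiv R S p h.le hpT hp⟩
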